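/- Let $\mathbb{N}=\{0,1,2,\dots\}$ and $\mathbb{C}_-=\{z\in\mathbb{C}:\operatorname{Im} z<0\}$. Let $S$ be an additive sub-semigroup of $[0,\infty)$ such that (S1) $\mathbb{N}\subset S$, and (S2) there is a constant $c>0$ with $\#(S\cap[n,n+1))\le c^{n+1}$ for all $n\in\mathbb{N}$; fix such a constant $c$. A probability measure $\mu$ on $\mathbb{R}$ is said to belong to $\mathcal{P}_S$ if there exist $a_\beta\in\mathbb{C}$ ($\beta\in S$, $\beta>0$) and $r,R>0$ such that $|a_\beta|\le r^\beta$ for all $\beta\in S$ with $\beta>0$, $r<c^{-1}R$, and $$\mu|_{|x|\ge R}(dx)=\sum_{\beta\in S,\ \beta>0}\operatorname{Im}\Bigl(a_\beta\Bigl(\frac1x\Bigr)^{\beta+1}\Bigr)\,dx,$$ where $(1/x)^{\beta+1}$ is understood as $e^{i(\beta+1)\pi}|x|^{-\beta-1}$ for $x\le -R$. For $z\in\mathbb{C}_-$ put $$G_\mu(z)=\int_{\mathbb{R}}\frac{1}{z-x}\,\mu(dx),\qquad F_\mu(z)=\frac{1}{G_\mu(z)},$$ and let $z^\gamma$ ($\gamma\in\mathbb{R}$)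 denote the principal value, $z^\gamma=e^{\gamma\log z}$ with $-\pi<\operatorname{Im}\log z<\pi$. Theorem. For every probability measure $\mu$ on $\mathbb{R}$ the following are equivalent. (1) $\mu\in\mathcal{P}_S$. (2) There exist $(d_\gamma)_{\gamma\in S}\subset\mathbb{C}$ with $d_0=1$ and $A>0$ such that $|d_\gamma|\le A^\gamma$ for all $\gamma\in S$ and $$G_\mu(z)=\sum_{\gamma\in S}\frac{d_\gamma}{z^{\gamma+1}}\qquad\text{for all } z\in\mathbb{C}_-\text{ with } |z|>cA.$$ (3) There exist $(b_\gamma)_{\gamma\in S}\subset\mathbb{C}$ with $b_0=1$ and $A>0$ such that $|b_\gamma|\le A^\gamma$ for all $\gamma\in S$ and $$F_\mu(z)=z\sum_{\gamma\in S}\frac{b_\gamma}{z^{\gamma}}\qquad\text{for all } z\in\mathbb{C}_-\text{ with } |z|>cA.$$ The series in (1), (2) and (3) are absolutely convergent on the indicated ranges. -/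

import Mathlib

open MeasureTheory

noncomputable section

/-- Condition on the exponent set: an additive sub-semigroup `S` of `[0, ∞)` which contains all the
natural numbers (so it is a submonoid, as `0` is a natural number), and which has at most
`c ^ (n + 1)` elements in `[n, n + 1)` for every natural number `n`. -/
structure IsExponentSet (S : AddSubmonoid ℝ) (c : ℝ) : Prop where
  nonneg : ∀ γ ∈ S, 0 ≤ γ
  nat_mem : ∀ n : ℕ, (n : ℝ) ∈ S
  pos : 0 < c
  finite : ∀ n : ℕ, ((S : Set ℝ) ∩ Set.Ico (n : ℝ) (n + 1)).Finite
  card_le : ∀ n : ℕ, (((S : Set ℝ) ∩ Set.Ico (n : ℝ) (n + 1)).ncard : ℝ) ≤ c ^ (n + 1)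

/-- The power `(1 / x) ^ s` for real `x ≠ 0`: the usual real power for `x > 0`,
and `exp (i s π) |x| ^ (-s)` for `x < 0`. -/
def invRealPow (x s : ℝ) : ℂ :=
  if 0 < x then (((1 / x) ^ s : ℝ) : ℂ)
  else Complex.exp (Complex.I * (s : ℂ) * (Real.pi : ℂ)) * ((|x| ^ (-s) : ℝ) : ℂ)

/-- The class `𝒫_S`, where `c` is the constant in the growth condition on `S`: on `{|x| ≥ R}` the
measure `μ` has the density `ρ x = ∑_{β ∈ S, β > 0} Im (a_β (1 / x) ^ (β + 1))`, where
`|a_β| ≤ r ^ β` and `r < c⁻¹ R`. Nonnegativity of `ρ` is part of `ρ dx` being a (positive) measure;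
it is stated because `ENNReal.ofReal` would truncate negative values. -/
def MemPS (S : AddSubmonoid ℝ) (c : ℝ) (μ : Measure ℝ) : Prop :=
  ∃ (a : {β : ℝ // β ∈ S ∧ 0 < β} → ℂ) (r R : ℝ) (ρ : ℝ → ℝ),
    0 < r ∧ 0 < R ∧
    (∀ x : ℝ, R ≤ |x| → 0 ≤ ρ x ∧
      HasSum (fun β : {β : ℝ // β ∈ S ∧ 0 < β} =>
        (a β * invRealPow x ((β : ℝ) + 1)).im) (ρ x)) ∧
    μ.restrict {x : ℝ | R ≤ |x|} =
      (volume.restrict {x : ℝ | R ≤ |x|}).withDensity (fun x => ENNReal.ofReal (ρ x)) ∧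
    (∀ β, ‖a β‖ ≤ r ^ (β : ℝ)) ∧
    r < c⁻¹ * R

/-- The Cauchy-Stieltjes transform `G_μ(z) = ∫ 1 / (z - x) μ(dx)`. -/
def cauchyStieltjes (μ : Measure ℝ) (z : ℂ) : ℂ := ∫ x : ℝ, 1 / (z - (x : ℂ)) ∂μ

/-- The reciprocal Cauchy transform `F_μ(z) = 1 / G_μ(z)`. -/
def reciprocalCauchy (μ : Measure ℝ) (z : ℂ) : ℂ := 1 / cauchyStieltjes μ z

end

open Filter Topology Set ComplexConjugate

noncomputable section

/-! ### Exponent sets: counting, summability, gap above zero. -/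

namespace IsExponentSet

variable {S : AddSubmonoid ℝ} {c : ℝ}

/-! In the coordinate ζ = log z, every series in the theorem becomes a generalized Dirichlet series
∑ d_γ e^(-γζ). Since [n, n+1) contains at most c^(n+1) exponents, it is dominated by a geometric
series, hence absolutely convergent and holomorphic, where e^(Re ζ) > cA.

(2) ⇔ (3) is inversion in the algebra of such series. Local finiteness of S makes Cauchy products
finite sums and lets the inverse coefficients be defined by well-founded recursion. They obey an
exponential bound with base A e^t, once t is so large that ∑_{γ≠0} e^(-tγ) ≤ 1
(`exists_expSum_inverse`).

(1) ⇒ (2). The convention for (1/x)^(β+1) at x < 0 is the boundary value from the lower half-plane,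
so the density is Im F(log x) with F(ζ) = ∑ a_β e^(-(β+1)ζ). Write Im F = (F - conj F)/2i and
integrate against 1/(z - x) along the boundary of the lower half-plane with the disc of radius R
removed. The F part picks up the residue at z; the conjugate part is the conjugate of the same
integral at conj z, which lies in the upper half-plane, and has no residue (`integral_im_outside`).
So G(z) is π F(log z), plus arc integrals, plus the contribution of μ on |x| < R. The last two are
Laurent series in integer powers, admissible because ℕ ⊂ S. Finally z G(z) → 1 forces d_0 = 1.

(2) ⇒ (1). Beyond a radius larger than cA, G is bounded and extends continuously to the real line
from below. Stieltjes inversion (`restrict_eq_withDensity_of_boundary_value`) then excludes atoms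
and gives the density Im G(x - i0)/π, so a_β = d_β/π; the term γ = 0 is 1/(πx), which is real and
drops out. -/

lemma one_le (hS : IsExponentSet S c) : 1 ≤ c := by
  have h := hS.card_le 0
  have h1 : 1 ≤ ((S : Set ℝ) ∩ Set.Ico ((0 : ℕ) : ℝ) ((0 : ℕ) + 1)).ncard := by
    rw [Nat.one_le_iff_ne_zero]
    refine (Set.ncard_pos (hS.finite 0)).2 ⟨0, S.zero_mem, by simp⟩ |>.ne'
  have h2 : (1 : ℝ) ≤ (((S : Set ℝ) ∩ Set.Ico ((0 : ℕ) : ℝ) ((0 : ℕ) + 1)).ncard : ℝ) := by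
    exact_mod_cast h1
  simpa using h2.trans h

lemma coe_nonneg (hS : IsExponentSet S c) (γ : S) : 0 ≤ (γ : ℝ) := hS.nonneg _ γ.2

lemma coe_pos (hS : IsExponentSet S c) {γ : S} (h : γ ≠ 0) : 0 < (γ : ℝ) :=
  lt_of_le_of_ne (hS.coe_nonneg γ) fun h' => h (Subtype.ext h'.symm)

/-- The natural number `n` as an element of an exponent set. -/
def natCast (hS : IsExponentSet S c) (n : ℕ) : S := ⟨n, hS.nat_mem n⟩

@[simp] lemma coe_natCast (hS : IsExponentSet S c) (n : ℕ) : (hS.natCast n : ℝ) = n := rfl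

lemma natCast_injective (hS : IsExponentSet S c) : Function.Injective hS.natCast := fun m n h => by
  simpa using congrArg (Subtype.val) h

lemma card_filter_floor_le (hS : IsExponentSet S c) (s : Finset S) (n : ℕ) :
    ((s.filter fun γ : S => ⌊(γ : ℝ)⌋₊ = n).card : ℝ) ≤ c ^ (n + 1) := by
  classical
  refine le_trans ?_ (hS.card_le n)
  rw [← Finset.card_map (Function.Embedding.subtype _), ← Set.ncard_coe_finset]
  refine Nat.cast_le.2 (Set.ncard_le_ncard ?_ (hS.finite n))
  intro x hx
  simp only [Finset.coe_map, Function.Embedding.coe_subtype, Set.mem_image, Finset.mem_coe,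
    Finset.mem_filter] at hx
  obtain ⟨γ, ⟨-, hγ⟩, rfl⟩ := hx
  exact ⟨γ.2, (Nat.floor_eq_iff (hS.coe_nonneg γ)).1 hγ⟩

/-- Group the exponents by integer part: as q ≤ 1, those with floor n contribute at most c^(n+1) q^n
= c (cq)^n. -/
lemma summable_rpow (hS : IsExponentSet S c) {q : ℝ} (hq : 0 < q) (hcq : c * q < 1) :
    Summable fun γ : S => q ^ (γ : ℝ) := by
  classical
  have hc := hS.one_le
  have hq1 : q ≤ 1 := by nlinarith
  have hgeo : Summable fun n : ℕ => c * (c * q) ^ n :=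
    (summable_geometric_of_lt_one (by positivity) hcq).mul_left c
  refine summable_of_sum_le (c := ∑' n : ℕ, c * (c * q) ^ n)
    (fun γ => by positivity) fun s => ?_
  calc ∑ γ ∈ s, q ^ (γ : ℝ) ≤ ∑ γ ∈ s, q ^ ⌊(γ : ℝ)⌋₊ := by
        refine Finset.sum_le_sum fun γ _ => ?_
        rw [← Real.rpow_natCast]
        exact Real.rpow_le_rpow_of_exponent_ge hq hq1 (Nat.floor_le (hS.coe_nonneg γ))
    _ = ∑ n ∈ s.image fun γ : S => ⌊(γ : ℝ)⌋₊, ∑ γ ∈ s.filter fun γ : S => ⌊(γ : ℝ)⌋₊ = n, q ^ ⌊(γ : ℝ)⌋₊ :=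
        (Finset.sum_fiberwise_of_maps_to (fun γ h => Finset.mem_image_of_mem _ h) _).symm
    _ ≤ ∑ n ∈ s.image fun γ : S => ⌊(γ : ℝ)⌋₊, c * (c * q) ^ n := by
        refine Finset.sum_le_sum fun n _ => ?_
        rw [Finset.sum_congr rfl (g := fun _ => q ^ n)
          (fun γ h => by rw [(Finset.mem_filter.1 h).2]), Finset.sum_const, nsmul_eq_mul, mul_pow,
          ← mul_assoc, ← pow_succ']
        exact mul_le_mul_of_nonneg_right (hS.card_filter_floor_le s n) (by positivity)
    _ ≤ ∑' n : ℕ, c * (c * q) ^ n := hgeo.sum_le_tsum _ fun n _ => by positivity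

lemma finite_Iic (hS : IsExponentSet S c) (γ : S) : (Set.Iic γ).Finite := by
  have h : ((S : Set ℝ) ∩ Set.Iic (γ : ℝ)).Finite := by
    refine Set.Finite.subset (Set.Finite.biUnion (Set.finite_Iic ⌊(γ : ℝ)⌋₊)
      fun n _ => hS.finite n) ?_
    rintro x ⟨hx, hxγ⟩
    simp only [Set.mem_iUnion]
    exact ⟨⌊x⌋₊, Nat.floor_le_floor hxγ, hx, Nat.floor_le (hS.nonneg x hx), Nat.lt_floor_add_one x⟩
  refine Set.Finite.of_finite_image (f := Subtype.val) (h.subset ?_) Subtype.val_injective.injOn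
  rintro _ ⟨x, hx, rfl⟩
  exact ⟨x.2, hx⟩

lemma exists_pos_le (hS : IsExponentSet S c) : ∃ δ > 0, ∀ γ : S, γ ≠ 0 → δ ≤ (γ : ℝ) := by
  -- The finite set of nonzero exponents at most 1 contains 1. Its minimal element bounds all
  -- nonzero exponents, since a smaller one would also lie in the set.
  have hfin := (hS.finite_Iic (hS.natCast 1)).subset
    (Set.inter_subset_right (s := {0}ᶜ))
  obtain ⟨m, hm, hmin⟩ := hfin.exists_minimal ⟨hS.natCast 1, by
    refine ⟨fun h => ?_, Set.mem_Iic.2 le_rfl⟩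
    simpa using congrArg Subtype.val (Set.mem_singleton_iff.1 h)⟩
  refine ⟨m, hS.coe_pos hm.1, fun γ hγ => ?_⟩
  by_contra! hlt
  have hlt' : γ < m := hlt
  exact absurd (hmin ⟨hγ, hlt'.le.trans hm.2⟩ hlt'.le) (not_le_of_gt hlt')

/-- Constant factors can be absorbed in the base of an exponential bound. -/
lemma exists_rpow_bound (hS : IsExponentSet S c) {A C : ℝ} (hA : 0 < A) :
    ∃ B, A ≤ B ∧ ∀ γ : S, γ ≠ 0 → C * A ^ (γ : ℝ) ≤ B ^ (γ : ℝ) := by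
  obtain ⟨δ, hδ, h⟩ := hS.exists_pos_le
  have h1 : 1 ≤ max 1 C := le_max_left _ _
  refine ⟨A * (max 1 C) ^ (1 / δ), ?_, fun γ hγ => ?_⟩
  · exact le_mul_of_one_le_right hA.le (Real.one_le_rpow h1 (by positivity))
  · rw [Real.mul_rpow hA.le (by positivity), mul_comm C, ← Real.rpow_mul (by positivity)]
    refine mul_le_mul_of_nonneg_left ((le_max_right 1 C).trans ?_) (by positivity)
    refine Real.self_le_rpow_of_one_le h1 ?_
    rw [one_div_mul_eq_div, le_div_iff₀ hδ, one_mul]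
    exact h γ hγ

end IsExponentSet

/-! ### Generalized Dirichlet series in the logarithmic coordinate. -/

/-- The generalized Dirichlet series `∑ d_γ e ^ (-γ ζ)`. With `ζ = log z` this is
`∑ d_γ z ^ (-γ)`. -/
def expSum {S : AddSubmonoid ℝ} (d : S → ℂ) (ζ : ℂ) : ℂ :=
  ∑' γ : S, d γ * Complex.exp (-((γ : ℝ) : ℂ) * ζ)

section expSum

variable {S : AddSubmonoid ℝ} {c A : ℝ} {d : S → ℂ}

lemma norm_exp_neg_mul (s : ℝ) (ζ : ℂ) :
    ‖Complex.exp (-(s : ℂ) * ζ)‖ = Real.exp (-ζ.re) ^ s := by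
  rw [Complex.norm_exp, ← Real.exp_mul]
  congr 1
  simp
  ring

lemma norm_expSum_term_le (hA : 0 < A) (hd : ∀ γ, ‖d γ‖ ≤ A ^ (γ : ℝ)) (γ : S) (ζ : ℂ) :
    ‖d γ * Complex.exp (-((γ : ℝ) : ℂ) * ζ)‖ ≤ (A * Real.exp (-ζ.re)) ^ (γ : ℝ) := by
  rw [norm_mul, norm_exp_neg_mul, Real.mul_rpow hA.le (Real.exp_pos _).le]
  exact mul_le_mul_of_nonneg_right (hd γ) (by positivity)

lemma norm_expSum_term_le_of_le (hS : IsExponentSet S c) (hA : 0 < A)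
    (hd : ∀ γ, ‖d γ‖ ≤ A ^ (γ : ℝ)) {σ : ℝ} {ζ : ℂ} (hζ : σ ≤ ζ.re) (γ : S) :
    ‖d γ * Complex.exp (-((γ : ℝ) : ℂ) * ζ)‖ ≤ (A * Real.exp (-σ)) ^ (γ : ℝ) := by
  refine (norm_expSum_term_le hA hd γ ζ).trans (Real.rpow_le_rpow (by positivity) ?_
    (hS.coe_nonneg γ))
  gcongr

lemma mul_mul_exp_neg_lt_one {σ : ℝ} (h : c * A < Real.exp σ) : c * (A * Real.exp (-σ)) < 1 := by
  rw [Real.exp_neg, ← mul_assoc, ← div_eq_mul_inv, div_lt_one (Real.exp_pos _)]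
  exact h

lemma summable_norm_expSum (hS : IsExponentSet S c) (hA : 0 < A)
    (hd : ∀ γ, ‖d γ‖ ≤ A ^ (γ : ℝ)) {ζ : ℂ} (hζ : c * A < Real.exp ζ.re) :
    Summable fun γ : S => ‖d γ * Complex.exp (-((γ : ℝ) : ℂ) * ζ)‖ :=
  Summable.of_nonneg_of_le (fun _ => norm_nonneg _) (fun γ => norm_expSum_term_le hA hd γ ζ)
    (hS.summable_rpow (by positivity) (mul_mul_exp_neg_lt_one hζ))

lemma norm_expSum_le (hS : IsExponentSet S c) (hA : 0 < A)
    (hd : ∀ γ, ‖d γ‖ ≤ A ^ (γ : ℝ)) {σ : ℝ} (hσ : c * A < Real.exp σ) {ζ : ℂ} (hζ : σ ≤ ζ.re) :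
    ‖expSum d ζ‖ ≤ ∑' γ : S, (A * Real.exp (-σ)) ^ (γ : ℝ) :=
  tsum_of_norm_bounded (hS.summable_rpow (by positivity) (mul_mul_exp_neg_lt_one hσ)).hasSum
    fun γ => norm_expSum_term_le_of_le hS hA hd hζ γ

lemma differentiableAt_expSum (hS : IsExponentSet S c) (hA : 0 < A)
    (hd : ∀ γ, ‖d γ‖ ≤ A ^ (γ : ℝ)) {ζ : ℂ} (hζ : c * A < Real.exp ζ.re) :
    DifferentiableAt ℂ (expSum d) ζ := by
  have hc := hS.pos
  obtain ⟨σ, h1, h2⟩ := exists_between ((Real.log_lt_iff_lt_exp (by positivity)).2 hζ)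
  rw [Real.log_lt_iff_lt_exp (by positivity)] at h1
  have hU : IsOpen {w : ℂ | σ < w.re} := isOpen_lt continuous_const Complex.continuous_re
  refine DifferentiableOn.differentiableAt (s := {w : ℂ | σ < w.re}) ?_ (hU.mem_nhds h2)
  refine Complex.differentiableOn_tsum_of_summable_norm
    (hS.summable_rpow (by positivity) (mul_mul_exp_neg_lt_one h1)) (fun γ => ?_) hU
    fun γ w hw => norm_expSum_term_le_of_le hS hA hd (le_of_lt hw) γ
  fun_prop

/-- Dominated convergence: every term with γ ≠ 0 decays as Re ζ → ∞, uniformly in Im ζ, which is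
what the filter `comap Complex.re atTop` expresses. -/
lemma tendsto_expSum (hS : IsExponentSet S c) (hA : 0 < A)
    (hd : ∀ γ, ‖d γ‖ ≤ A ^ (γ : ℝ)) :
    Tendsto (expSum d) (comap Complex.re atTop) (𝓝 (d 0)) := by
  have hc := hS.pos
  obtain ⟨σ, hσ⟩ := exists_gt (Real.log (c * A))
  have h1 := (Real.log_lt_iff_lt_exp (by positivity)).1 hσ
  have hlim : ∀ γ : S, Tendsto (fun ζ : ℂ => d γ * Complex.exp (-((γ : ℝ) : ℂ) * ζ))
      (comap Complex.re atTop) (𝓝 (if γ = 0 then d 0 else 0)) := by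
    intro γ
    split_ifs with h
    · subst h
      simpa using tendsto_const_nhds
    · rw [← mul_zero (d γ)]
      refine Tendsto.const_mul _ ?_
      rw [tendsto_zero_iff_norm_tendsto_zero]
      have h2 : Tendsto (fun t : ℝ => Real.exp (-((γ : ℝ) * t))) atTop (𝓝 0) :=
        Real.tendsto_exp_neg_atTop_nhds_zero.comp
          (tendsto_id.const_mul_atTop (hS.coe_pos h))
      refine (h2.comp (tendsto_comap (f := Complex.re))).congr fun ζ => ?_
      rw [norm_exp_neg_mul, ← Real.exp_mul]
      simp only [Function.comp]
      congr 1
      ring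
  have h := tendsto_tsum_of_dominated_convergence
    (hS.summable_rpow (by positivity) (mul_mul_exp_neg_lt_one h1)) hlim (by
      filter_upwards [tendsto_comap.eventually (eventually_ge_atTop σ)] with ζ hζ γ
      exact norm_expSum_term_le_of_le hS hA hd hζ γ)
  rwa [tsum_ite_eq] at h

lemma exp_neg_mul_log {z : ℂ} (hz : z ≠ 0) (s : ℂ) :
    Complex.exp (-s * Complex.log z) = (z ^ s)⁻¹ := by
  rw [Complex.cpow_def_of_ne_zero hz, ← Complex.exp_neg]
  congr 1
  ring

lemma expSum_term_log {z : ℂ} (hz : z ≠ 0) (d : S → ℂ) (γ : S) :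
    d γ * Complex.exp (-((γ : ℝ) : ℂ) * Complex.log z) = d γ / z ^ ((γ : ℝ) : ℂ) := by
  rw [exp_neg_mul_log hz, div_eq_mul_inv]

lemma div_cpow_add_one {z : ℂ} (hz : z ≠ 0) (d : S → ℂ) (γ : S) :
    d γ / z ^ (((γ : ℝ) : ℂ) + 1) =
      z⁻¹ * (d γ * Complex.exp (-((γ : ℝ) : ℂ) * Complex.log z)) := by
  rw [expSum_term_log hz, Complex.cpow_add _ _ hz, Complex.cpow_one]
  field_simp

lemma exp_log_re {z : ℂ} (hz : z ≠ 0) : Real.exp (Complex.log z).re = ‖z‖ := by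
  rw [Complex.log_re, Real.exp_log (norm_pos_iff.2 hz)]

end expSum

/-! ### Multiplicative inverses of series with exponents in S. -/

namespace IsExponentSet

variable {S : AddSubmonoid ℝ} {c : ℝ}

lemma wellFoundedLT (hS : IsExponentSet S c) : WellFoundedLT S := by
  refine StrictMono.wellFoundedLT (f := fun γ : S => (Set.Iio γ).ncard) fun α β h => ?_
  refine Set.ncard_lt_ncard ?_ ((hS.finite_Iic β).subset Set.Iio_subset_Iic_self)
  exact ⟨Set.Iio_subset_Iio h.le, fun h' => lt_irrefl α (h' (Set.mem_Iio.2 h))⟩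

lemma finite_add_eq (hS : IsExponentSet S c) (γ : S) : {p : S × S | p.1 + p.2 = γ}.Finite := by
  refine ((hS.finite_Iic γ).prod (hS.finite_Iic γ)).subset ?_
  rintro ⟨α, β⟩ h
  have h1 := hS.coe_nonneg α
  have h2 := hS.coe_nonneg β
  have h3 : (α : ℝ) + β = γ := congrArg Subtype.val h
  exact ⟨show (α : ℝ) ≤ γ by linarith, show (β : ℝ) ≤ γ by linarith⟩

/-- Every element of an exponent set has finitely many decompositions as a sum. -/
@[reducible] def hasAntidiagonal (hS : IsExponentSet S c) : Finset.HasAntidiagonal S where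
  antidiagonal γ := (hS.finite_add_eq γ).toFinset
  mem_antidiagonal := by simp

lemma lt_of_add_eq (hS : IsExponentSet S c) {α β γ : S} (h : α + β = γ) (hα : α ≠ 0) : β < γ := by
  have h1 := hS.coe_pos hα
  have h3 : (α : ℝ) + β = γ := congrArg Subtype.val h
  exact show (β : ℝ) < γ by linarith

/-- The pairs `(α, β)` with `α + β = γ` and `α ≠ 0`. -/
def properDecompositions (hS : IsExponentSet S c) (γ : S) : Finset (S × S) :=
  ((hS.finite_add_eq γ).subset
    (fun _ h => h.1 : {p : S × S | p.1 + p.2 = γ ∧ p.1 ≠ 0} ⊆ _)).toFinset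

lemma mem_properDecompositions (hS : IsExponentSet S c) {γ : S} {p : S × S} :
    p ∈ hS.properDecompositions γ ↔ p.1 + p.2 = γ ∧ p.1 ≠ 0 := by
  simp [properDecompositions]

/-- When d 0 = 1, the recursion isolates b γ in the vanishing of the γ-th coefficient of the Cauchy
product; only b at exponents below γ appear, because the first component is nonzero. -/
lemma exists_convolution_inverse (hS : IsExponentSet S c) (d : S → ℂ) :
    ∃ b : S → ℂ, b 0 = 1 ∧
      ∀ γ ≠ 0, b γ = -∑ p ∈ hS.properDecompositions γ, d p.1 * b p.2 := by
  classical
  have hwf := hS.wellFoundedLT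
  let F : (γ : S) → ((β : S) → β < γ → ℂ) → ℂ := fun γ rec =>
    if γ = 0 then 1 else -∑ p ∈ (hS.properDecompositions γ).attach,
      d p.1.1 * rec p.1.2 (hS.lt_of_add_eq (hS.mem_properDecompositions.1 p.2).1
        (hS.mem_properDecompositions.1 p.2).2)
  refine ⟨hwf.wf.fix F, ?_, fun γ hγ => ?_⟩
  · rw [WellFounded.fix_eq]
    simp [F]
  · rw [WellFounded.fix_eq]
    simp only [F, if_neg hγ]
    rw [← Finset.sum_attach (hS.properDecompositions γ)]

lemma exists_sum_exp_le_one (hS : IsExponentSet S c) :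
    ∃ t : ℝ, 0 ≤ t ∧ ∀ s : Finset S, 0 ∉ s → ∑ γ ∈ s, Real.exp (-t) ^ (γ : ℝ) ≤ 1 := by
  classical
  have h1 : ∀ γ : S, ‖(1 : ℂ)‖ ≤ (1 : ℝ) ^ (γ : ℝ) := by simp
  have hlim := tendsto_expSum hS one_pos (d := fun _ : S => (1 : ℂ)) h1
  have hre : Tendsto (fun t : ℝ => (t : ℂ)) atTop (comap Complex.re atTop) :=
    tendsto_comap_iff.2 tendsto_id
  have hev := (tendsto_iff_norm_sub_tendsto_zero.1 (hlim.comp hre)).eventually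
    (ge_mem_nhds one_pos : ∀ᶠ x in 𝓝 (0 : ℝ), x ≤ 1)
  obtain ⟨t, ⟨ht1, ht⟩, ht0⟩ := ((hev.and (Real.tendsto_exp_atTop.eventually
    (eventually_gt_atTop c))).and (eventually_ge_atTop 0)).exists
  refine ⟨t, ht0, fun s hs => ?_⟩
  have hsum : Summable fun γ : S => Real.exp (-t) ^ (γ : ℝ) :=
    hS.summable_rpow (Real.exp_pos _) (by simpa using mul_mul_exp_neg_lt_one (A := 1) (by simpa))
  have hval : expSum (fun _ : S => (1 : ℂ)) t = ((∑' γ : S, Real.exp (-t) ^ (γ : ℝ) : ℝ) : ℂ) := by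
    rw [expSum, Complex.ofReal_tsum]
    refine tsum_congr fun γ => ?_
    rw [← Real.exp_mul]
    push_cast
    rw [one_mul]
    congr 1
    ring
  -- The whole sum tends to its γ = 0 term, which is 1, so it is at most 2 at this t; removing that
  -- term leaves at most 1.
  have hle := hsum.sum_le_tsum (insert 0 s) fun γ _ => by positivity
  rw [Finset.sum_insert hs] at hle
  simp only [Function.comp, hval] at ht1
  rw [← Complex.ofReal_one, ← Complex.ofReal_sub, Complex.norm_real] at ht1
  have := (le_abs_self _).trans ht1
  simp only [ZeroMemClass.coe_zero, Real.rpow_zero] at hle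
  linarith

/-- Induction with B = A e^t: if α + β = γ, then A^α B^β = e^(-tα) B^γ. Each α occurs in one
decomposition only, so summing over α ≠ 0 costs a factor at most 1. -/
lemma norm_convolution_inverse_le (hS : IsExponentSet S c) {A t : ℝ} {d b : S → ℂ} (hA : 0 < A)
    (hd : ∀ γ, ‖d γ‖ ≤ A ^ (γ : ℝ)) (hb0 : b 0 = 1)
    (hb : ∀ γ ≠ 0, b γ = -∑ p ∈ hS.properDecompositions γ, d p.1 * b p.2)
    (ht : ∀ s : Finset S, 0 ∉ s → ∑ γ ∈ s, Real.exp (-t) ^ (γ : ℝ) ≤ 1) (γ : S) :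
    ‖b γ‖ ≤ (A * Real.exp t) ^ (γ : ℝ) := by
  classical
  have hBpos : 0 < A * Real.exp t := by positivity
  have hwf := hS.wellFoundedLT
  induction γ using hwf.wf.induction with
  | _ γ ih =>
  by_cases hγ : γ = 0
  · subst hγ
    simp [hb0]
  rw [hb γ hγ, norm_neg]
  have hinj : Set.InjOn (Prod.fst : S × S → S) (hS.properDecompositions γ : Set (S × S)) := by
    rintro ⟨α, β⟩ h ⟨α', β'⟩ h' (rfl : α = α')
    have h1 := (hS.mem_properDecompositions.1 h).1
    have h2 := (hS.mem_properDecompositions.1 h').1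
    exact Prod.ext rfl (add_left_cancel (h1.trans h2.symm))
  calc ‖∑ p ∈ hS.properDecompositions γ, d p.1 * b p.2‖
      ≤ ∑ p ∈ hS.properDecompositions γ,
          Real.exp (-t) ^ (p.1 : ℝ) * (A * Real.exp t) ^ (γ : ℝ) := by
        refine norm_sum_le_of_le _ fun p hp => ?_
        obtain ⟨hp1, hp2⟩ := hS.mem_properDecompositions.1 hp
        have hsum : (p.1 : ℝ) + p.2 = γ := congrArg Subtype.val hp1
        have hexp : Real.exp (-t) * (A * Real.exp t) = A := by
          rw [mul_left_comm, ← Real.exp_add, neg_add_cancel, Real.exp_zero, mul_one]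
        rw [norm_mul, ← hsum, Real.rpow_add hBpos, ← mul_assoc,
          ← Real.mul_rpow (Real.exp_pos _).le hBpos.le, hexp]
        exact mul_le_mul (hd _) (ih _ (hS.lt_of_add_eq hp1 hp2)) (norm_nonneg _) (by positivity)
    _ = (∑ α ∈ (hS.properDecompositions γ).image Prod.fst, Real.exp (-t) ^ (α : ℝ)) *
          (A * Real.exp t) ^ (γ : ℝ) := by
        rw [Finset.sum_image hinj, Finset.sum_mul]
    _ ≤ (A * Real.exp t) ^ (γ : ℝ) := by
        refine mul_le_of_le_one_left (by positivity) (ht _ fun h => ?_)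
        obtain ⟨p, hp, hp0⟩ := Finset.mem_image.1 h
        exact (hS.mem_properDecompositions.1 hp).2 hp0

lemma sum_antidiagonal_convolution_inverse (hS : IsExponentSet S c) {d b : S → ℂ}
    (h0 : d 0 = 1) (hb0 : b 0 = 1)
    (hb : ∀ γ ≠ 0, b γ = -∑ p ∈ hS.properDecompositions γ, d p.1 * b p.2) (γ : S) :
    ∑ p ∈ (hS.finite_add_eq γ).toFinset, d p.1 * b p.2 = if γ = 0 then 1 else 0 := by
  classical
  have hanti : (hS.finite_add_eq γ).toFinset = insert (0, γ) (hS.properDecompositions γ) := by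
    ext p
    rw [Set.Finite.mem_toFinset, Set.mem_ofPred_eq, Finset.mem_insert, hS.mem_properDecompositions]
    constructor
    · intro h
      by_cases hp : p.1 = 0
      · refine Or.inl (Prod.ext hp ?_)
        rwa [hp, zero_add] at h
      · exact Or.inr ⟨h, hp⟩
    · rintro (rfl | h)
      · exact zero_add γ
      · exact h.1
  rw [hanti, Finset.sum_insert fun h => (hS.mem_properDecompositions.1 h).2 rfl, h0, one_mul]
  split_ifs with hγ
  · subst hγ
    rw [hb0, Finset.sum_eq_zero, add_zero]
    intro p hp
    obtain ⟨hp1, hp2⟩ := hS.mem_properDecompositions.1 hp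
    have h3 : (p.1 : ℝ) + p.2 = 0 := congrArg Subtype.val hp1
    exact absurd h3 (add_pos_of_pos_of_nonneg (hS.coe_pos hp2) (hS.coe_nonneg _)).ne'
  · rw [hb γ hγ, neg_add_cancel]

lemma _root_.expSum_mul_expSum_eq_one [Finset.HasAntidiagonal S] {d b : S → ℂ} {ζ : ℂ}
    (hdb : ∀ γ : S, ∑ p ∈ Finset.HasAntidiagonal.antidiagonal γ, d p.1 * b p.2 =
      if γ = 0 then 1 else 0)
    (hsd : Summable fun γ : S => ‖d γ * Complex.exp (-((γ : ℝ) : ℂ) * ζ)‖)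
    (hsb : Summable fun γ : S => ‖b γ * Complex.exp (-((γ : ℝ) : ℂ) * ζ)‖) :
    expSum d ζ * expSum b ζ = 1 := by
  have hterm : ∀ γ : S, ∑ p ∈ Finset.HasAntidiagonal.antidiagonal γ,
      d p.1 * Complex.exp (-((p.1 : ℝ) : ℂ) * ζ) * (b p.2 * Complex.exp (-((p.2 : ℝ) : ℂ) * ζ)) =
        if γ = 0 then 1 else 0 := by
    intro γ
    calc _ = ∑ p ∈ Finset.HasAntidiagonal.antidiagonal γ,
          d p.1 * b p.2 * Complex.exp (-((γ : ℝ) : ℂ) * ζ) := by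
          refine Finset.sum_congr rfl fun p hp => ?_
          have h3 : (p.1 : ℝ) + p.2 = γ :=
            congrArg Subtype.val (Finset.HasAntidiagonal.mem_antidiagonal.1 hp)
          rw [mul_mul_mul_comm, ← Complex.exp_add, ← h3]
          push_cast
          ring_nf
      _ = (if γ = 0 then 1 else 0) * Complex.exp (-((γ : ℝ) : ℂ) * ζ) := by
          rw [← Finset.sum_mul, hdb]
      _ = _ := by
          split_ifs with hγ
          · subst hγ
            simp
          · simp
  have hprod := summable_mul_of_summable_norm hsd hsb
  have hcauchy := hsd.of_norm.tsum_mul_tsum_eq_tsum_sum_antidiagonal hsb.of_norm hprod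
  rw [expSum, expSum, hcauchy, tsum_congr hterm]
  exact tsum_ite_eq 0 _

/-- A series in `z ^ (-γ)`, `γ ∈ S`, with constant term `1` has a multiplicative inverse of the
same form. -/
lemma exists_expSum_inverse (hS : IsExponentSet S c) {A : ℝ} {d : S → ℂ} (hA : 0 < A)
    (h0 : d 0 = 1) (hd : ∀ γ, ‖d γ‖ ≤ A ^ (γ : ℝ)) :
    ∃ (b : S → ℂ) (B : ℝ), A ≤ B ∧ b 0 = 1 ∧ (∀ γ, ‖b γ‖ ≤ B ^ (γ : ℝ)) ∧
      ∀ ζ : ℂ, c * B < Real.exp ζ.re → expSum d ζ * expSum b ζ = 1 := by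
  obtain ⟨b, hb0, hb⟩ := hS.exists_convolution_inverse d
  obtain ⟨t, ht0, ht⟩ := hS.exists_sum_exp_le_one
  have hAB : A ≤ A * Real.exp t := le_mul_of_one_le_right hA.le (Real.one_le_exp ht0)
  have hbB := hS.norm_convolution_inverse_le hA hd hb0 hb ht
  refine ⟨b, A * Real.exp t, hAB, hb0, hbB, fun ζ hζ => ?_⟩
  exact @expSum_mul_expSum_eq_one S hS.hasAntidiagonal d b ζ
    (hS.sum_antidiagonal_convolution_inverse h0 hb0 hb)
    (summable_norm_expSum hS hA hd ((mul_le_mul_of_nonneg_left hAB hS.pos.le).trans_lt hζ))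
    (summable_norm_expSum hS (hA.trans_le hAB) hbB hζ)

end IsExponentSet

/-! ### Cauchy's theorem and integral formula on rectangles. -/

/-- The integral of `f` along the boundary of the rectangle `[a, b] × [p, q]`. -/
def rectBoundaryIntegral (f : ℂ → ℂ) (a b p q : ℝ) : ℂ :=
  (∫ x : ℝ in a..b, f (x + p * Complex.I)) - (∫ x : ℝ in a..b, f (x + q * Complex.I)) +
    Complex.I * (∫ y : ℝ in p..q, f (b + y * Complex.I)) -
    Complex.I * (∫ y : ℝ in p..q, f (a + y * Complex.I))

section Rectangle

variable {a b p q : ℝ} {f g : ℂ → ℂ}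

/-- The boundary of the rectangle `[a, b] × [p, q]`. -/
def rectBoundary (a b p q : ℝ) : Set ℂ :=
  {ζ | ζ.re ∈ Icc a b ∧ ζ.im ∈ Icc p q ∧ (ζ.re = a ∨ ζ.re = b ∨ ζ.im = p ∨ ζ.im = q)}

lemma rectBoundaryIntegral_add (hab : a ≤ b) (hpq : p ≤ q)
    (hf : ContinuousOn f (rectBoundary a b p q)) (hg : ContinuousOn g (rectBoundary a b p q)) :
    rectBoundaryIntegral (fun ζ => f ζ + g ζ) a b p q =
      rectBoundaryIntegral f a b p q + rectBoundaryIntegral g a b p q := by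
  have hor : ∀ {h : ℂ → ℂ}, ContinuousOn h (rectBoundary a b p q) → ∀ y, y = p ∨ y = q →
      IntervalIntegrable (fun x : ℝ => h (x + y * Complex.I)) volume a b := by
    intro h hh y hy
    refine ContinuousOn.intervalIntegrable (hh.comp (by fun_prop) fun x hx => ?_)
    rw [uIcc_of_le hab] at hx
    simp only [rectBoundary, mem_ofPred_eq, Complex.add_re, Complex.ofReal_re, Complex.mul_re,
      Complex.ofReal_im, Complex.I_re, Complex.I_im, Complex.add_im, Complex.mul_im]
    rcases hy with rfl | rfl <;> simp [hx.1, hx.2, hpq]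
  have ver : ∀ {h : ℂ → ℂ}, ContinuousOn h (rectBoundary a b p q) → ∀ x, x = a ∨ x = b →
      IntervalIntegrable (fun y : ℝ => h (x + y * Complex.I)) volume p q := by
    intro h hh y hy
    refine ContinuousOn.intervalIntegrable (hh.comp (by fun_prop) fun x hx => ?_)
    rw [uIcc_of_le hpq] at hx
    simp only [rectBoundary, mem_ofPred_eq, Complex.add_re, Complex.ofReal_re, Complex.mul_re,
      Complex.ofReal_im, Complex.I_re, Complex.I_im, Complex.add_im, Complex.mul_im]
    rcases hy with rfl | rfl <;> simp [hx.1, hx.2, hab]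
  simp only [rectBoundaryIntegral]
  rw [intervalIntegral.integral_add (hor hf p (.inl rfl)) (hor hg p (.inl rfl)),
    intervalIntegral.integral_add (hor hf q (.inr rfl)) (hor hg q (.inr rfl)),
    intervalIntegral.integral_add (ver hf a (.inl rfl)) (ver hg a (.inl rfl)),
    intervalIntegral.integral_add (ver hf b (.inr rfl)) (ver hg b (.inr rfl))]
  ring

lemma rectBoundaryIntegral_const_mul (w : ℂ) :
    rectBoundaryIntegral (fun ζ => w * f ζ) a b p q = w * rectBoundaryIntegral f a b p q := by
  simp only [rectBoundaryIntegral, intervalIntegral.integral_const_mul]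
  ring

lemma rectBoundaryIntegral_congr (hab : a ≤ b) (hpq : p ≤ q)
    (h : ∀ ζ ∈ rectBoundary a b p q, f ζ = g ζ) :
    rectBoundaryIntegral f a b p q = rectBoundaryIntegral g a b p q := by
  simp only [rectBoundaryIntegral]
  congr 1
  · congr 1
    · congr 1 <;>
      · refine intervalIntegral.integral_congr fun x hx => h _ ?_
        rw [uIcc_of_le hab] at hx
        simp [rectBoundary, hx.1, hx.2, hpq]
    · congr 1
      refine intervalIntegral.integral_congr fun x hx => h _ ?_
      rw [uIcc_of_le hpq] at hx
      simp [rectBoundary, hx.1, hx.2, hab]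
  · congr 1
    refine intervalIntegral.integral_congr fun x hx => h _ ?_
    rw [uIcc_of_le hpq] at hx
    simp [rectBoundary, hx.1, hx.2, hab]

lemma rectBoundaryIntegral_eq_zero (hab : a ≤ b) (hpq : p ≤ q)
    (hf : ∀ ζ : ℂ, ζ.re ∈ Icc a b → ζ.im ∈ Icc p q → DifferentiableAt ℂ f ζ) :
    rectBoundaryIntegral f a b p q = 0 := by
  have h := Complex.integral_boundary_rect_eq_zero_of_differentiableOn f (⟨a, p⟩) (⟨b, q⟩)
    (fun ζ hζ => by
      simp only [uIcc_of_le hab, uIcc_of_le hpq, Complex.mem_reProdIm] at hζ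
      exact (hf ζ hζ.1 hζ.2).differentiableWithinAt)
  simpa [rectBoundaryIntegral] using h

lemma integral_inv_of_slitPlane {u v : ℝ} {w m : ℂ}
    (h : ∀ x ∈ uIcc u v, w + x * m ∈ Complex.slitPlane) :
    m * ∫ x in u..v, (w + x * m)⁻¹ = Complex.log (w + v * m) - Complex.log (w + u * m) := by
  rw [← intervalIntegral.integral_const_mul]
  refine intervalIntegral.integral_eq_sub_of_hasDerivAt (f := fun x : ℝ => Complex.log (w + x * m))
    (fun x hx => ?_) ?_
  · have h1 : HasDerivAt (fun x : ℝ => w + x * m) m x := by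
      simpa using ((Complex.ofRealCLM.hasDerivAt (x := x)).mul_const m).const_add w
    simpa [div_eq_mul_inv] using h1.clog_real (h x hx)
  · refine ContinuousOn.intervalIntegrable (continuousOn_const.mul (ContinuousOn.inv₀ (by fun_prop)
      fun x hx => Complex.slitPlane_ne_zero (h x hx)))

lemma log_neg_of_im_pos {w : ℂ} (h : 0 < w.im) :
    Complex.log (-w) = Complex.log w - Real.pi * Complex.I := by
  rw [Complex.log, Complex.log, Complex.arg_neg_eq_arg_sub_pi_of_im_pos h, norm_neg]
  push_cast
  ring

lemma log_neg_of_im_neg {w : ℂ} (h : w.im < 0) :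
    Complex.log (-w) = Complex.log w + Real.pi * Complex.I := by
  rw [Complex.log, Complex.log, Complex.arg_neg_eq_arg_add_pi_of_im_neg h, norm_neg]
  push_cast
  ring

/-- The principal logarithm is a primitive on three sides. The left side crosses the branch cut, so
log(-w) is used there; its jumps of ∓πi against log w at the two corners add up to 2πi. -/
lemma rectBoundaryIntegral_inv {ζ₀ : ℂ} (ha : a < ζ₀.re) (hb : ζ₀.re < b) (hp : p < ζ₀.im)
    (hq : ζ₀.im < q) :
    rectBoundaryIntegral (fun ζ => (ζ - ζ₀)⁻¹) a b p q = 2 * Real.pi * Complex.I := by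
  have bot : (∫ x : ℝ in a..b, ((x : ℂ) + p * Complex.I - ζ₀)⁻¹) =
      Complex.log (b + p * Complex.I - ζ₀) - Complex.log (a + p * Complex.I - ζ₀) := by
    have := integral_inv_of_slitPlane (u := a) (v := b) (w := p * Complex.I - ζ₀) (m := 1)
      (fun x _ => by
        rw [Complex.mem_slitPlane_iff]; right; simp; linarith)
    simpa only [one_mul, mul_one, add_sub_assoc, add_comm (↑p * Complex.I - ζ₀)] using this
  have top : (∫ x : ℝ in a..b, ((x : ℂ) + q * Complex.I - ζ₀)⁻¹) =
      Complex.log (b + q * Complex.I - ζ₀) - Complex.log (a + q * Complex.I - ζ₀) := by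
    have := integral_inv_of_slitPlane (u := a) (v := b) (w := q * Complex.I - ζ₀) (m := 1)
      (fun x _ => by
        rw [Complex.mem_slitPlane_iff]; right; simp; linarith)
    simpa only [one_mul, mul_one, add_sub_assoc, add_comm (↑q * Complex.I - ζ₀)] using this
  have right : Complex.I * (∫ y : ℝ in p..q, ((b : ℂ) + y * Complex.I - ζ₀)⁻¹) =
      Complex.log (b + q * Complex.I - ζ₀) - Complex.log (b + p * Complex.I - ζ₀) := by
    have := integral_inv_of_slitPlane (u := p) (v := q) (w := b - ζ₀) (m := Complex.I)
      (fun x _ => by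
        rw [Complex.mem_slitPlane_iff]; left; simp; linarith)
    simpa only [add_sub_right_comm] using this
  have left : Complex.I * (∫ y : ℝ in p..q, ((a : ℂ) + y * Complex.I - ζ₀)⁻¹) =
      Complex.log (-(a + q * Complex.I - ζ₀)) - Complex.log (-(a + p * Complex.I - ζ₀)) := by
    have := integral_inv_of_slitPlane (u := p) (v := q) (w := ζ₀ - a) (m := -Complex.I)
      (fun x _ => by
        rw [Complex.mem_slitPlane_iff]; left; simp; linarith)
    have h2 : ∀ y : ℝ, ζ₀ - a + y * -Complex.I = -((a : ℂ) + y * Complex.I - ζ₀) := fun y => by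
      ring
    simp only [h2, inv_neg, intervalIntegral.integral_neg, neg_mul_neg] at this
    exact this
  rw [log_neg_of_im_pos (by simp; linarith), log_neg_of_im_neg (by simp; linarith)] at left
  rw [rectBoundaryIntegral, bot, top, right, left]
  ring

/-- **Cauchy's integral formula** for a rectangle. -/
lemma rectBoundaryIntegral_div_sub {ζ₀ : ℂ} {U : Set ℂ} (hU : IsOpen U)
    (ha : a < ζ₀.re) (hb : ζ₀.re < b) (hp : p < ζ₀.im) (hq : ζ₀.im < q)
    (hUr : ∀ ζ : ℂ, ζ.re ∈ Icc a b → ζ.im ∈ Icc p q → ζ ∈ U) (hf : DifferentiableOn ℂ f U) :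
    rectBoundaryIntegral (fun ζ => f ζ / (ζ - ζ₀)) a b p q =
      2 * Real.pi * Complex.I * f ζ₀ := by
  have hab := (ha.trans hb).le
  have hpq := (hp.trans hq).le
  have hmem : ζ₀ ∈ U := hUr _ ⟨ha.le, hb.le⟩ ⟨hp.le, hq.le⟩
  have hd : DifferentiableOn ℂ (dslope f ζ₀) U :=
    (Complex.differentiableOn_dslope (hU.mem_nhds hmem)).2 hf
  have hsub : rectBoundary a b p q ⊆ U := fun ζ hζ => hUr ζ hζ.1 hζ.2.1
  have hne : ∀ ζ ∈ rectBoundary a b p q, ζ - ζ₀ ≠ 0 := by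
    rintro ζ ⟨-, -, h⟩ h0
    rw [sub_eq_zero] at h0
    subst h0
    rcases h with h | h | h | h <;> linarith
  -- Split f(ζ)/(ζ - ζ₀) into the holomorphic difference quotient, which integrates to zero, and
  -- f(ζ₀)/(ζ - ζ₀).
  rw [rectBoundaryIntegral_congr hab hpq
    (g := fun ζ => dslope f ζ₀ ζ + f ζ₀ * (ζ - ζ₀)⁻¹), rectBoundaryIntegral_add hab hpq,
    rectBoundaryIntegral_const_mul, rectBoundaryIntegral_inv ha hb hp hq,
    rectBoundaryIntegral_eq_zero hab hpq]
  · ring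
  · exact fun ζ h1 h2 => hd.differentiableAt (hU.mem_nhds (hUr ζ h1 h2))
  · exact hd.continuousOn.mono hsub
  · exact continuousOn_const.mul (ContinuousOn.inv₀ (by fun_prop) hne)
  · intro ζ hζ
    have h := hne ζ hζ
    rw [dslope_of_ne _ (sub_ne_zero.1 h), slope_def_field]
    field_simp
    ring

end Rectangle

/-! ### Contour integrals on the half-strip -π ≤ Im ζ ≤ 0. -/

/-- The integrand `F(ζ) e^ζ / (z - e^ζ)`, which is `F(log w) / (z - w) dw` in the logarithmic
coordinate `ζ = log w`. -/
def logCauchyKernel (F : ℂ → ℂ) (z ζ : ℂ) : ℂ := F ζ * Complex.exp ζ / (z - Complex.exp ζ)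

/-- The integral of `F(log w) / (z - w) dw / i` along the lower half of the circle of radius
`exp L`. -/
def arcIntegral (F : ℂ → ℂ) (L : ℝ) (z : ℂ) : ℂ :=
  ∫ y : ℝ in -Real.pi..0, logCauchyKernel F z (L + y * Complex.I)

section Strip

variable {F : ℂ → ℂ} {L L₀ M : ℝ} {z : ℂ}

/-- Let the right side of the rectangle go to infinity: its contribution is O(e^(-T)). -/
lemma strip_integral_of_rect {k : ℂ → ℂ} {T₀ : ℝ} {V : ℂ}
    (hV : ∀ T, T₀ < T → rectBoundaryIntegral k L T (-Real.pi) 0 = V)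
    (hk : ∀ ζ : ℂ, T₀ ≤ ζ.re → ‖k ζ‖ ≤ M * Real.exp (-ζ.re))
    (hbot : IntegrableOn (fun t : ℝ => k (t + (-Real.pi : ℝ) * Complex.I)) (Ioi L))
    (htop : IntegrableOn (fun t : ℝ => k (t + (0 : ℝ) * Complex.I)) (Ioi L)) :
    (∫ t : ℝ in Ioi L, k (t + (-Real.pi : ℝ) * Complex.I)) -
      (∫ t : ℝ in Ioi L, k (t + (0 : ℝ) * Complex.I)) -
      Complex.I * (∫ y : ℝ in -Real.pi..0, k (L + y * Complex.I)) = V := by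
  have h1 := intervalIntegral_tendsto_integral_Ioi L hbot tendsto_id
  have h2 := intervalIntegral_tendsto_integral_Ioi L htop tendsto_id
  have h3 : Tendsto (fun T : ℝ => ∫ y : ℝ in -Real.pi..0, k (T + y * Complex.I)) atTop (𝓝 0) := by
    have hb : Tendsto (fun T : ℝ => M * Real.exp (-T) * |0 - -Real.pi|) atTop (𝓝 0) := by
      simpa using (Real.tendsto_exp_neg_atTop_nhds_zero.const_mul M).mul_const |0 - -Real.pi|
    refine squeeze_zero_norm' ?_ hb
    filter_upwards [eventually_ge_atTop T₀] with T hT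
    refine intervalIntegral.norm_integral_le_of_norm_le_const fun y _ => ?_
    simpa using hk (T + y * Complex.I) (by simpa using hT)
  have h4 := ((h1.sub h2).add (h3.const_mul Complex.I)).sub_const
    (Complex.I * (∫ y : ℝ in -Real.pi..0, k (L + y * Complex.I)))
  rw [mul_zero, add_zero] at h4
  refine tendsto_nhds_unique h4 (tendsto_const_nhds.congr' ?_)
  filter_upwards [eventually_gt_atTop T₀] with T hT
  exact (hV T hT).symm

lemma norm_logCauchyKernel_le (hM : ∀ ζ : ℂ, L ≤ ζ.re → ‖F ζ‖ ≤ M * Real.exp (-ζ.re))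
    {ζ : ℂ} (h1 : L ≤ ζ.re) (h2 : 2 * ‖z‖ < Real.exp ζ.re) :
    ‖logCauchyKernel F z ζ‖ ≤ 2 * M * Real.exp (-ζ.re) := by
  have he : ‖Complex.exp ζ‖ = Real.exp ζ.re := Complex.norm_exp ζ
  have h3 : Real.exp ζ.re / 2 ≤ ‖z - Complex.exp ζ‖ := by
    have := norm_sub_norm_le (Complex.exp ζ) z
    rw [norm_sub_rev] at this
    linarith
  have h4 := hM ζ h1
  have hpos := Real.exp_pos ζ.re
  rw [logCauchyKernel, norm_div, norm_mul, he, div_le_iff₀ (by linarith)]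
  have h5 : ‖F ζ‖ * Real.exp ζ.re ≤ M := by
    calc _ ≤ M * Real.exp (-ζ.re) * Real.exp ζ.re := by gcongr
      _ = M := by rw [mul_assoc, ← Real.exp_add]; simp
  have hM0 : 0 ≤ M := le_trans (by positivity) h5
  calc _ ≤ M := h5
    _ = 2 * M * Real.exp (-ζ.re) * (Real.exp ζ.re / 2) := by
      have : Real.exp (-ζ.re) * Real.exp ζ.re = 1 := by rw [← Real.exp_add]; simp
      linear_combination -M * this
    _ ≤ _ := by gcongr

lemma integrableOn_logCauchyKernel (hL : L₀ < L) (hF : DifferentiableOn ℂ F {ζ | L₀ < ζ.re})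
    (hM : ∀ ζ : ℂ, L ≤ ζ.re → ‖F ζ‖ ≤ M * Real.exp (-ζ.re)) (p : ℝ)
    (hz : ∀ t : ℝ, z ≠ Complex.exp (t + p * Complex.I)) :
    IntegrableOn (fun t : ℝ => logCauchyKernel F z (t + p * Complex.I)) (Ioi L) := by
  have hexp : IntegrableAtFilter (fun t : ℝ => Real.exp (-t)) atTop :=
    ⟨Ioi 0, Ioi_mem_atTop 0, integrableOn_exp_neg_Ioi 0⟩
  refine ((ContinuousOn.locallyIntegrableOn ?_ measurableSet_Ici).integrableOn_of_isBigO_atTop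
    ?_ hexp).mono_set Ioi_subset_Ici_self
  · refine ContinuousOn.div (ContinuousOn.mul ?_ (by fun_prop)) (by fun_prop)
      fun t _ => sub_ne_zero.2 (hz t)
    refine hF.continuousOn.comp (by fun_prop) fun t ht => ?_
    simpa using hL.trans_le ht
  · refine Asymptotics.IsBigO.of_bound (2 * M) ?_
    filter_upwards [eventually_ge_atTop L,
      Real.tendsto_exp_atTop.eventually (eventually_gt_atTop (2 * ‖z‖))] with t h1 h2
    have := norm_logCauchyKernel_le (z := z) hM (ζ := t + p * Complex.I) (by simpa) (by simpa)
    simpa using this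

lemma exp_re_im (t p : ℝ) : (Complex.exp (t + p * Complex.I)).im = Real.exp t * Real.sin p := by
  simp [Complex.exp_im]

lemma exists_forall_ge_norm_logCauchyKernel_le
    (hM : ∀ ζ : ℂ, L ≤ ζ.re → ‖F ζ‖ ≤ M * Real.exp (-ζ.re)) (z : ℂ) (l : ℝ) :
    ∃ T₀, l ≤ T₀ ∧ ∀ ζ : ℂ, T₀ ≤ ζ.re →
      ‖logCauchyKernel F z ζ‖ ≤ 2 * M * Real.exp (-ζ.re) := by
  obtain ⟨T₀, h1, h2, h3⟩ := ((eventually_ge_atTop l).and ((eventually_ge_atTop L).and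
    (Real.tendsto_exp_atTop.eventually (eventually_gt_atTop (2 * ‖z‖))))).exists
  refine ⟨T₀, h1, fun ζ hζ => norm_logCauchyKernel_le hM (h2.trans hζ) (h3.trans_le ?_)⟩
  exact Real.exp_le_exp.2 hζ

lemma ne_exp_of_im_ne_zero (hz : z.im ≠ 0) {p : ℝ} (hp : Real.sin p = 0) (t : ℝ) :
    z ≠ Complex.exp (t + p * Complex.I) := by
  rintro rfl
  rw [exp_re_im, hp, mul_zero] at hz
  exact hz rfl

/-- The exponential maps the strip into the closed lower half-plane, so the kernel has no pole when
z is in the upper one. -/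
lemma strip_integral_of_im_pos (hL : L₀ < L) (hF : DifferentiableOn ℂ F {ζ | L₀ < ζ.re})
    (hM : ∀ ζ : ℂ, L ≤ ζ.re → ‖F ζ‖ ≤ M * Real.exp (-ζ.re)) (hz : 0 < z.im) :
    (∫ t : ℝ in Ioi L, logCauchyKernel F z (t + (-Real.pi : ℝ) * Complex.I)) -
      (∫ t : ℝ in Ioi L, logCauchyKernel F z (t + (0 : ℝ) * Complex.I)) -
      Complex.I * arcIntegral F L z = 0 := by
  obtain ⟨T₀, hT, hk⟩ := exists_forall_ge_norm_logCauchyKernel_le hM z L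
  have hU : IsOpen {ζ : ℂ | L₀ < ζ.re} := isOpen_lt continuous_const Complex.continuous_re
  refine strip_integral_of_rect (fun T hT' => ?_) hk
    (integrableOn_logCauchyKernel hL hF hM _ (ne_exp_of_im_ne_zero hz.ne' (by simp)))
    (integrableOn_logCauchyKernel hL hF hM _ (ne_exp_of_im_ne_zero hz.ne' (by simp)))
  refine rectBoundaryIntegral_eq_zero (hT.trans hT'.le) (by linarith [Real.pi_pos])
    fun ζ h1 h2 => ?_
  have hd : DifferentiableAt ℂ F ζ := hF.differentiableAt (hU.mem_nhds (hL.trans_le h1.1))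
  refine DifferentiableAt.div (hd.mul Complex.differentiableAt_exp) (by fun_prop) ?_
  rw [sub_ne_zero]
  rintro rfl
  rw [Complex.exp_im] at hz
  have := Real.sin_nonpos_of_nonpos_of_neg_pi_le h2.2 h2.1
  nlinarith [Real.exp_pos ζ.re]

/-- Points with equal exponentials differ by a multiple of 2πi; at ζ₀ itself the slope is the
derivative e^(ζ₀). -/
lemma dslope_exp_ne_zero {ζ₀ ζ : ℂ} (h : |ζ.im - ζ₀.im| < 2 * Real.pi) :
    dslope Complex.exp ζ₀ ζ ≠ 0 := by
  by_cases hne : ζ = ζ₀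
  · subst hne
    rw [dslope_same, Complex.deriv_exp]
    exact Complex.exp_ne_zero _
  · rw [dslope_of_ne _ hne, slope_def_field]
    refine div_ne_zero (fun h0 => hne ?_) (sub_ne_zero.2 hne)
    rw [sub_eq_zero, Complex.exp_eq_exp_iff_exists_int] at h0
    obtain ⟨n, hn⟩ := h0
    have him := congrArg Complex.im hn
    simp only [Complex.add_im, Complex.mul_im, Complex.intCast_re, Complex.intCast_im,
      Complex.mul_re, Complex.I_re, Complex.I_im, Complex.ofReal_re, Complex.ofReal_im,
      Complex.re_ofNat, Complex.im_ofNat] at him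
    have hn0 : n = 0 := by
      have h1 : |(n : ℝ)| * (2 * Real.pi) < 1 * (2 * Real.pi) := by
        rw [one_mul, ← abs_of_pos Real.two_pi_pos, ← abs_mul, abs_of_pos Real.two_pi_pos]
        have h' : (n : ℝ) * (2 * Real.pi) = ζ.im - ζ₀.im := by
          rw [him]
          ring
        rwa [h']
      have h2 := lt_of_mul_lt_mul_right h1 Real.two_pi_pos.le
      rw [← Int.cast_abs] at h2
      exact Int.abs_lt_one_iff.1 (by exact_mod_cast h2)
    simpa [hn0] using hn

/-- With e^ζ - e^(ζ₀) = (ζ - ζ₀) · `dslope`, the kernel is -(F e^ζ / `dslope`)/(ζ - ζ₀), and the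
numerator equals F(ζ₀) at ζ₀. Cauchy's formula applies. -/
lemma strip_integral_of_pole (hL : L₀ < L) (hF : DifferentiableOn ℂ F {ζ | L₀ < ζ.re})
    (hM : ∀ ζ : ℂ, L ≤ ζ.re → ‖F ζ‖ ≤ M * Real.exp (-ζ.re)) {ζ₀ : ℂ} (h1 : L < ζ₀.re)
    (h2 : -Real.pi < ζ₀.im) (h3 : ζ₀.im < 0) :
    (∫ t : ℝ in Ioi L, logCauchyKernel F (Complex.exp ζ₀) (t + (-Real.pi : ℝ) * Complex.I)) -
      (∫ t : ℝ in Ioi L, logCauchyKernel F (Complex.exp ζ₀) (t + (0 : ℝ) * Complex.I)) -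
      Complex.I * arcIntegral F L (Complex.exp ζ₀) = -(2 * Real.pi * Complex.I * F ζ₀) := by
  obtain ⟨T₀, hT, hk⟩ := exists_forall_ge_norm_logCauchyKernel_le hM (Complex.exp ζ₀) ζ₀.re
  have him : (Complex.exp ζ₀).im ≠ 0 := by
    rw [Complex.exp_im]
    exact mul_ne_zero (Real.exp_pos _).ne' (Real.sin_neg_of_neg_of_neg_pi_lt h3 h2).ne
  refine strip_integral_of_rect (fun T hT' => ?_) hk
    (integrableOn_logCauchyKernel hL hF hM _ (ne_exp_of_im_ne_zero him (by simp)))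
    (integrableOn_logCauchyKernel hL hF hM _ (ne_exp_of_im_ne_zero him (by simp)))
  have hUo : IsOpen ({ζ : ℂ | L₀ < ζ.re} ∩ {ζ : ℂ | |ζ.im - ζ₀.im| < 2 * Real.pi}) :=
    (isOpen_lt continuous_const Complex.continuous_re).inter
      (isOpen_lt (by fun_prop) continuous_const)
  have hexp : Differentiable ℂ (dslope Complex.exp ζ₀) := differentiableOn_univ.1
    ((Complex.differentiableOn_dslope univ_mem).2 Complex.differentiable_exp.differentiableOn)
  have hmain := rectBoundaryIntegral_div_sub
    (f := fun ζ => F ζ * Complex.exp ζ / dslope Complex.exp ζ₀ ζ) hUo h1 (hT.trans_lt hT') h2 h3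
    (fun ζ hr hi => ⟨hL.trans_le hr.1, by
      rw [mem_ofPred_eq, abs_lt]
      constructor <;> linarith [hi.1, hi.2, Real.pi_pos]⟩)
    (((hF.mono inter_subset_left).mul Complex.differentiable_exp.differentiableOn).div
      hexp.differentiableOn fun ζ hζ => dslope_exp_ne_zero hζ.2)
  rw [dslope_same, Complex.deriv_exp, mul_div_cancel_right₀ _ (Complex.exp_ne_zero _)] at hmain
  rw [← hmain, neg_eq_neg_one_mul (rectBoundaryIntegral _ _ _ _ _), ← rectBoundaryIntegral_const_mul]
  refine rectBoundaryIntegral_congr (h1.trans (hT.trans_lt hT')).le (h2.trans h3).le fun ζ hζ => ?_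
  have hne : ζ ≠ ζ₀ := by
    rintro rfl
    rcases hζ.2.2 with h | h | h | h <;> linarith
  rw [dslope_of_ne _ hne, slope_def_field, div_div, div_mul_cancel₀ _ (sub_ne_zero.2 hne),
    logCauchyKernel, ← neg_sub, div_neg, neg_one_mul]

end Strip

/-! ### From the edges of the strip to the real line. -/

section RealLine

/-- The boundary values on the real line of the logarithm on the lower half-plane. -/
def lowerLog (x : ℝ) : ℂ := if 0 < x then Real.log x else Real.log |x| + (-Real.pi : ℝ) * Complex.I

lemma lowerLog_exp (t : ℝ) : lowerLog (Real.exp t) = t + (0 : ℝ) * Complex.I := by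
  simp [lowerLog, Real.exp_pos]

lemma lowerLog_neg_exp (t : ℝ) :
    lowerLog (-Real.exp t) = t + (-Real.pi : ℝ) * Complex.I := by
  simp [lowerLog, (Real.exp_pos t).le]

lemma lowerLog_re (x : ℝ) : (lowerLog x).re = Real.log |x| := by
  unfold lowerLog
  split_ifs with h
  · simp [abs_of_pos h]
  · simp

/-- The factor e^(isπ) for x < 0 corresponds to log x = log |x| - iπ, the branch reached from below.
-/
lemma invRealPow_eq_exp {x : ℝ} (hx : x ≠ 0) (s : ℝ) :
    invRealPow x s = Complex.exp (-(s : ℂ) * lowerLog x) := by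
  unfold invRealPow lowerLog
  split_ifs with h
  · rw [one_div, Real.inv_rpow h.le, ← Real.rpow_neg h.le, Real.rpow_def_of_pos h]
    push_cast
    ring_nf
  · rw [Real.rpow_def_of_pos (abs_pos.2 hx), Complex.ofReal_exp, ← Complex.exp_add]
    push_cast
    ring_nf

lemma image_exp_Ici (L : ℝ) : Real.exp '' Ici L = Ici (Real.exp L) := by
  ext x
  constructor
  · rintro ⟨t, ht, rfl⟩
    exact Real.exp_le_exp.2 ht
  · intro hx
    have hpos : 0 < x := (Real.exp_pos L).trans_le hx
    exact ⟨Real.log x, (Real.le_log_iff_exp_le hpos).2 hx, Real.exp_log hpos⟩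

lemma image_neg_exp_Ici (L : ℝ) : (fun t => -Real.exp t) '' Ici L = Iic (-Real.exp L) := by
  rw [← image_image (fun x => -x) Real.exp, image_exp_Ici, image_neg_eq_neg, neg_Ici]

lemma setOf_le_abs (R : ℝ) : {x : ℝ | R ≤ |x|} = Iic (-R) ∪ Ici R := by
  ext x
  rw [mem_ofPred_eq, le_abs', mem_union, mem_Iic, mem_Ici]

/-- Substitute x = e^t and x = -e^t. The minus sign on the edge Im ζ = -π appears because e^(t - iπ)
= -e^t while the Jacobian enters through its absolute value. -/
lemma integral_outside_eq {L : ℝ} {Φ : ℝ → ℂ} {k : ℂ → ℂ}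
    (h1 : ∀ t : ℝ, L ≤ t → (Real.exp t : ℂ) * Φ (Real.exp t) = k (t + (0 : ℝ) * Complex.I))
    (h2 : ∀ t : ℝ, L ≤ t →
      (Real.exp t : ℂ) * Φ (-Real.exp t) = -k (t + (-Real.pi : ℝ) * Complex.I))
    (hbot : IntegrableOn (fun t : ℝ => k (t + (-Real.pi : ℝ) * Complex.I)) (Ioi L))
    (htop : IntegrableOn (fun t : ℝ => k (t + (0 : ℝ) * Complex.I)) (Ioi L)) :
    IntegrableOn Φ {x : ℝ | Real.exp L ≤ |x|} ∧
    ∫ x in {x : ℝ | Real.exp L ≤ |x|}, Φ x =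
      (∫ t : ℝ in Ioi L, k (t + (0 : ℝ) * Complex.I)) -
        ∫ t : ℝ in Ioi L, k (t + (-Real.pi : ℝ) * Complex.I) := by
  have hd1 : ∀ t ∈ Ici L, HasDerivWithinAt Real.exp (Real.exp t) (Ici L) t :=
    fun t _ => (Real.hasDerivAt_exp t).hasDerivWithinAt
  have hd2 : ∀ t ∈ Ici L, HasDerivWithinAt (fun t => -Real.exp t) (-Real.exp t) (Ici L) t :=
    fun t _ => (Real.hasDerivAt_exp t).neg.hasDerivWithinAt
  have hi1 : InjOn Real.exp (Ici L) := Real.exp_injective.injOn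
  have hi2 : InjOn (fun t => -Real.exp t) (Ici L) :=
    (neg_injective.comp Real.exp_injective).injOn
  have he1 : EqOn (fun t : ℝ => |Real.exp t| • Φ (Real.exp t))
      (fun t : ℝ => k (t + (0 : ℝ) * Complex.I)) (Ici L) := fun t ht => by
    simp only [Real.abs_exp, Complex.real_smul]
    exact h1 t ht
  have he2 : EqOn (fun t : ℝ => |-Real.exp t| • Φ (-Real.exp t))
      (fun t : ℝ => -k (t + (-Real.pi : ℝ) * Complex.I)) (Ici L) := fun t ht => by
    simp only [abs_neg, Real.abs_exp, Complex.real_smul]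
    exact h2 t ht
  have hint1 : IntegrableOn Φ (Ici (Real.exp L)) := by
    rw [← image_exp_Ici, integrableOn_image_iff_integrableOn_abs_deriv_smul measurableSet_Ici hd1 hi1,
      integrableOn_congr_fun he1 measurableSet_Ici, integrableOn_Ici_iff_integrableOn_Ioi]
    exact htop
  have hint2 : IntegrableOn Φ (Iic (-Real.exp L)) := by
    rw [← image_neg_exp_Ici,
      integrableOn_image_iff_integrableOn_abs_deriv_smul measurableSet_Ici hd2 hi2,
      integrableOn_congr_fun he2 measurableSet_Ici, integrableOn_Ici_iff_integrableOn_Ioi]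
    exact hbot.neg
  have hdisj : Disjoint (Iic (-Real.exp L)) (Ici (Real.exp L)) := by
    rw [Set.disjoint_left]
    intro x hx hx'
    rw [mem_Iic] at hx
    rw [mem_Ici] at hx'
    linarith [Real.exp_pos L]
  rw [setOf_le_abs]
  refine ⟨hint2.union hint1, ?_⟩
  rw [setIntegral_union hdisj measurableSet_Ici hint2 hint1, ← image_exp_Ici,
    ← image_neg_exp_Ici, integral_image_eq_integral_abs_deriv_smul measurableSet_Ici hd1 hi1,
    integral_image_eq_integral_abs_deriv_smul measurableSet_Ici hd2 hi2,
    setIntegral_congr_fun measurableSet_Ici he1, setIntegral_congr_fun measurableSet_Ici he2,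
    integral_neg, integral_Ici_eq_integral_Ioi, integral_Ici_eq_integral_Ioi]
  ring

variable {F : ℂ → ℂ} {L L₀ M : ℝ} {z : ℂ}

lemma integral_outside_lowerLog (hL : L₀ < L) (hF : DifferentiableOn ℂ F {ζ | L₀ < ζ.re})
    (hM : ∀ ζ : ℂ, L ≤ ζ.re → ‖F ζ‖ ≤ M * Real.exp (-ζ.re)) (hz : z.im ≠ 0) :
    IntegrableOn (fun x : ℝ => F (lowerLog x) / (z - x)) {x : ℝ | Real.exp L ≤ |x|} ∧
    ∫ x in {x : ℝ | Real.exp L ≤ |x|}, F (lowerLog x) / (z - x) =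
      (∫ t : ℝ in Ioi L, logCauchyKernel F z (t + (0 : ℝ) * Complex.I)) -
        ∫ t : ℝ in Ioi L, logCauchyKernel F z (t + (-Real.pi : ℝ) * Complex.I) := by
  refine integral_outside_eq (fun t _ => ?_) (fun t _ => ?_)
    (integrableOn_logCauchyKernel hL hF hM _ (ne_exp_of_im_ne_zero hz (by simp)))
    (integrableOn_logCauchyKernel hL hF hM _ (ne_exp_of_im_ne_zero hz (by simp)))
  · rw [lowerLog_exp, logCauchyKernel]
    simp only [Complex.ofReal_zero, zero_mul, add_zero, Complex.ofReal_exp]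
    ring
  · rw [lowerLog_neg_exp, logCauchyKernel]
    have : Complex.exp (t + (-Real.pi : ℝ) * Complex.I) = -Complex.exp t := by
      rw [Complex.exp_add]
      simp [Complex.exp_neg]
    rw [this]
    push_cast
    ring

lemma integral_outside_of_im_pos (hL : L₀ < L) (hF : DifferentiableOn ℂ F {ζ | L₀ < ζ.re})
    (hM : ∀ ζ : ℂ, L ≤ ζ.re → ‖F ζ‖ ≤ M * Real.exp (-ζ.re)) (hz : 0 < z.im) :
    ∫ x in {x : ℝ | Real.exp L ≤ |x|}, F (lowerLog x) / (z - x) =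
      -(Complex.I * arcIntegral F L z) := by
  rw [(integral_outside_lowerLog hL hF hM hz.ne').2]
  linear_combination -strip_integral_of_im_pos hL hF hM hz

lemma integral_outside_of_im_neg (hL : L₀ < L) (hF : DifferentiableOn ℂ F {ζ | L₀ < ζ.re})
    (hM : ∀ ζ : ℂ, L ≤ ζ.re → ‖F ζ‖ ≤ M * Real.exp (-ζ.re)) (hz : z.im < 0)
    (hzL : Real.exp L < ‖z‖) :
    ∫ x in {x : ℝ | Real.exp L ≤ |x|}, F (lowerLog x) / (z - x) =
      2 * Real.pi * Complex.I * F (Complex.log z) - Complex.I * arcIntegral F L z := by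
  have hz0 : z ≠ 0 := by
    rintro rfl
    simp at hz
  have h := strip_integral_of_pole hL hF hM (ζ₀ := Complex.log z)
    (by rw [← Real.exp_lt_exp, exp_log_re hz0]; exact hzL) (Complex.neg_pi_lt_log_im z)
    (by rw [Complex.log_im]; exact Complex.arg_neg_iff.2 hz)
  rw [Complex.exp_log hz0] at h
  rw [(integral_outside_lowerLog hL hF hM hz.ne).2]
  linear_combination -h

end RealLine

/-! ### Laurent expansions of Cauchy integrals over bounded sets. -/

section Laurent

/-- A Cauchy integral over a set of points of modulus at most `R` has a Laurent expansion in
`|z| > R`. -/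
lemma exists_laurent_integral {X : Type*} [MeasurableSpace X] (ν : Measure X) [IsFiniteMeasure ν]
    {k w : X → ℂ} (hk : AEStronglyMeasurable k ν) (hw : AEStronglyMeasurable w ν) {K R : ℝ}
    (hR : 0 < R) (hkK : ∀ᵐ x ∂ν, ‖k x‖ ≤ K) (hwR : ∀ᵐ x ∂ν, ‖w x‖ ≤ R) :
    ∃ (m : ℕ → ℂ) (C : ℝ), (∀ n, ‖m n‖ ≤ C * R ^ n) ∧
      ∀ z : ℂ, R < ‖z‖ → HasSum (fun n => m n / z ^ (n + 1)) (∫ x, k x / (z - w x) ∂ν) := by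
  have hbd : ∀ n, ∀ᵐ x ∂ν, ‖k x * w x ^ n‖ ≤ K * R ^ n := fun n => by
    filter_upwards [hkK, hwR] with x h1 h2
    rw [norm_mul, norm_pow]
    exact mul_le_mul h1 (pow_le_pow_left₀ (norm_nonneg _) h2 n) (by positivity)
      ((norm_nonneg _).trans h1)
  have hint : ∀ n, Integrable (fun x => k x * w x ^ n) ν := fun n =>
    Integrable.of_bound (hk.mul (hw.pow n)) _ (hbd n)
  have hnorm : ∀ n, ∫ x, ‖k x * w x ^ n‖ ∂ν ≤ K * ν.real univ * R ^ n := fun n => by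
    refine (integral_mono_ae (hint n).norm (integrable_const _) (hbd n)).trans_eq ?_
    rw [integral_const, smul_eq_mul]
    ring
  refine ⟨fun n => ∫ x, k x * w x ^ n ∂ν, K * ν.real univ,
    fun n => (norm_integral_le_integral_norm _).trans (hnorm n), fun z hz => ?_⟩
  have hz0 : 0 < ‖z‖ := hR.trans hz
  have hzne : z ≠ 0 := norm_pos_iff.1 hz0
  have hsum : Summable fun n => ∫ x, ‖k x * w x ^ n / z ^ (n + 1)‖ ∂ν := by
    refine Summable.of_nonneg_of_le (fun n => by positivity) (fun n => ?_)
      ((summable_geometric_of_lt_one (r := R / ‖z‖) (by positivity)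
        ((div_lt_one hz0).2 hz)).mul_left (K * ν.real univ / ‖z‖))
    simp_rw [norm_div]
    rw [integral_div, norm_pow, div_le_iff₀ (by positivity)]
    refine (hnorm n).trans_eq ?_
    rw [div_pow, pow_succ]
    field_simp
  have h := hasSum_integral_of_summable_integral_norm
    (fun n => (hint n).div_const (z ^ (n + 1))) hsum
  simp_rw [integral_div] at h
  -- Pointwise geometric series in w/z, of modulus less than 1.
  have hcongr : ∫ x, k x / (z - w x) ∂ν = ∫ x, ∑' n : ℕ, k x * w x ^ n / z ^ (n + 1) ∂ν := by
    refine integral_congr_ae ?_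
    filter_upwards [hwR] with x hx
    have hlt : ‖w x / z‖ < 1 := by
      rw [norm_div, div_lt_one hz0]
      exact hx.trans_lt hz
    have hgeo := (hasSum_geometric_of_norm_lt_one hlt).mul_left (k x / z)
    have hne : z - w x ≠ 0 := by
      rw [sub_ne_zero]
      rintro rfl
      exact absurd (hx.trans_lt hz) (lt_irrefl _)
    have hval : k x / z * (1 - w x / z)⁻¹ = k x / (z - w x) := by
      rw [one_sub_div hzne, inv_div]
      field_simp
    rw [hval] at hgeo
    rw [← hgeo.tsum_eq]
    refine tsum_congr fun n => ?_
    rw [div_pow, pow_succ]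
    field_simp
  rw [hcongr]
  exact h

/-- `g` is the sum of a Laurent series `∑ m_n z ^ (-n-1)` with `m_n = O(R ^ n)`, at every point of
the lower half-plane of modulus larger than `R`. -/
def HasLaurentExpansion (R : ℝ) (g : ℂ → ℂ) : Prop :=
  ∃ (m : ℕ → ℂ) (C : ℝ), (∀ n, ‖m n‖ ≤ C * R ^ n) ∧
    ∀ z : ℂ, z.im < 0 → R < ‖z‖ → HasSum (fun n => m n / z ^ (n + 1)) (g z)

variable {R : ℝ} {g g₁ g₂ : ℂ → ℂ}

lemma HasLaurentExpansion.add (h₁ : HasLaurentExpansion R g₁) (h₂ : HasLaurentExpansion R g₂) :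
    HasLaurentExpansion R (fun z => g₁ z + g₂ z) := by
  obtain ⟨m₁, C₁, hb₁, hs₁⟩ := h₁
  obtain ⟨m₂, C₂, hb₂, hs₂⟩ := h₂
  refine ⟨fun n => m₁ n + m₂ n, C₁ + C₂, fun n => ?_, fun z hz hzR => ?_⟩
  · rw [add_mul]
    exact norm_add_le_of_le (hb₁ n) (hb₂ n)
  · simpa only [add_div] using (hs₁ z hz hzR).add (hs₂ z hz hzR)

lemma HasLaurentExpansion.const_mul (w : ℂ) (h : HasLaurentExpansion R g) :
    HasLaurentExpansion R (fun z => w * g z) := by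
  obtain ⟨m, C, hb, hs⟩ := h
  refine ⟨fun n => w * m n, ‖w‖ * C, fun n => ?_, fun z hz hzR => ?_⟩
  · rw [norm_mul, mul_assoc]
    exact mul_le_mul_of_nonneg_left (hb n) (norm_nonneg _)
  · simpa only [mul_div_assoc] using (hs z hz hzR).mul_left w

end Laurent

/-! ### The arc terms and the Cauchy transform of the density. -/

section Arc

variable {F : ℂ → ℂ} {L L₀ M : ℝ}

lemma continuous_arc (hL : L₀ < L) (hF : DifferentiableOn ℂ F {ζ | L₀ < ζ.re}) :
    Continuous fun y : ℝ => F (L + y * Complex.I) :=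
  hF.continuousOn.comp_continuous (by fun_prop) fun y => by simpa using hL

lemma norm_arc_le (hM : ∀ ζ : ℂ, L ≤ ζ.re → ‖F ζ‖ ≤ M * Real.exp (-ζ.re)) (y : ℝ) :
    ‖F (L + y * Complex.I) * Complex.exp (L + y * Complex.I)‖ ≤ M := by
  have h := hM (L + y * Complex.I) (by simp)
  rw [norm_mul, Complex.norm_exp]
  simp only [Complex.add_re, Complex.ofReal_re, Complex.re_ofReal_mul, Complex.I_re, mul_zero,
    add_zero] at h ⊢
  calc _ ≤ M * Real.exp (-L) * Real.exp L := by gcongr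
    _ = M := by rw [mul_assoc, ← Real.exp_add]; simp

lemma norm_exp_arc (L y : ℝ) : ‖Complex.exp (L + y * Complex.I)‖ = Real.exp L := by
  simp [Complex.norm_exp]

lemma hasLaurentExpansion_arcIntegral (hL : L₀ < L)
    (hF : DifferentiableOn ℂ F {ζ | L₀ < ζ.re})
    (hM : ∀ ζ : ℂ, L ≤ ζ.re → ‖F ζ‖ ≤ M * Real.exp (-ζ.re)) :
    HasLaurentExpansion (Real.exp L) (arcIntegral F L) := by
  have hc := continuous_arc hL hF
  have he : Continuous fun y : ℝ => Complex.exp (L + y * Complex.I) := by fun_prop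
  obtain ⟨m, C, hb, hs⟩ := exists_laurent_integral (volume.restrict (Ioc (-Real.pi) 0))
    (hc.mul he).aestronglyMeasurable he.aestronglyMeasurable (Real.exp_pos L)
    (.of_forall (norm_arc_le hM)) (.of_forall fun y => (norm_exp_arc L y).le)
  refine ⟨m, C, hb, fun z _ hzR => ?_⟩
  rw [arcIntegral, intervalIntegral.integral_of_le (by linarith [Real.pi_pos])]
  exact hs z hzR

/-- Conjugating twice gives a Cauchy integral over the reflected arc, still on the circle of radius
e^L. -/
lemma hasLaurentExpansion_conj_arcIntegral (hL : L₀ < L)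
    (hF : DifferentiableOn ℂ F {ζ | L₀ < ζ.re})
    (hM : ∀ ζ : ℂ, L ≤ ζ.re → ‖F ζ‖ ≤ M * Real.exp (-ζ.re)) :
    HasLaurentExpansion (Real.exp L) (fun z => conj (arcIntegral F L (conj z))) := by
  have hc := continuous_arc hL hF
  have he : Continuous fun y : ℝ => Complex.exp (L + y * Complex.I) := by fun_prop
  obtain ⟨m, C, hb, hs⟩ := exists_laurent_integral (volume.restrict (Ioc (-Real.pi) 0))
    (Complex.continuous_conj.comp (hc.mul he)).aestronglyMeasurable
    (Complex.continuous_conj.comp he).aestronglyMeasurable (Real.exp_pos L)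
    (.of_forall fun y => by
      simpa only [Function.comp, RCLike.norm_conj, Pi.mul_apply] using norm_arc_le hM y)
    (.of_forall fun y => by
      simpa only [Function.comp, RCLike.norm_conj] using (norm_exp_arc L y).le)
  refine ⟨m, C, hb, fun z _ hzR => ?_⟩
  have heq : conj (arcIntegral F L (conj z)) = _ :=
    (congrArg conj (intervalIntegral.integral_of_le (by linarith [Real.pi_pos]))).trans
      integral_conj.symm
  have hval := hs z hzR
  simp only [Function.comp, Pi.mul_apply] at hval
  show HasSum _ (conj (arcIntegral F L (conj z)))
  rw [heq]
  simpa only [logCauchyKernel, Function.comp, map_div₀, map_sub, Complex.conj_conj] using hval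

/-- The Cauchy transform of the density `Im F(log x)` on `{|x| ≥ e ^ L}`. -/
lemma integral_im_outside (hL : L₀ < L) (hF : DifferentiableOn ℂ F {ζ | L₀ < ζ.re})
    (hM : ∀ ζ : ℂ, L ≤ ζ.re → ‖F ζ‖ ≤ M * Real.exp (-ζ.re)) {z : ℂ} (hz : z.im < 0)
    (hzL : Real.exp L < ‖z‖) :
    ∫ x in {x : ℝ | Real.exp L ≤ |x|}, ((F (lowerLog x)).im : ℂ) / (z - x) =
      Real.pi * F (Complex.log z) +
        (-(1 / 2)) * (arcIntegral F L z + conj (arcIntegral F L (conj z))) := by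
  have hz' : 0 < (conj z).im := by simpa using hz
  have h1 := integral_outside_of_im_neg hL hF hM hz hzL
  have h2 := congrArg conj (integral_outside_of_im_pos hL hF hM hz')
  rw [← integral_conj] at h2
  simp only [map_neg, map_mul, Complex.conj_I] at h2
  have i1 := (integral_outside_lowerLog hL hF hM hz.ne).1
  have i2 : IntegrableOn (fun x : ℝ => conj (F (lowerLog x) / (conj z - x)))
      {x : ℝ | Real.exp L ≤ |x|} :=
    (Complex.conjCLE.toContinuousLinearMap.integrable_comp
      (integral_outside_lowerLog hL hF hM hz'.ne').1 :)
  -- Im F = (F - conj F)/2i, with the second part written as a conjugate at conj z so that the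
  -- residue-free formula applies to it.
  have hpt : ∀ x : ℝ, ((F (lowerLog x)).im : ℂ) / (z - x) =
      (2 * Complex.I)⁻¹ * (F (lowerLog x) / (z - x) - conj (F (lowerLog x) / (conj z - x))) := by
    intro x
    simp only [map_div₀, map_sub, Complex.conj_conj, Complex.conj_ofReal]
    rw [Complex.im_eq_sub_conj]
    ring
  simp_rw [hpt]
  rw [integral_const_mul, integral_sub i1 i2, h1, h2]
  field_simp
  ring_nf

end Arc

/-! ### Basic bounds and the behaviour of the Cauchy transform at infinity. -/

section CauchyStieltjes

variable {z : ℂ}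

lemma sub_ofReal_ne_zero (hz : z.im ≠ 0) (x : ℝ) : z - x ≠ 0 := by
  intro h
  apply hz
  simpa using congrArg Complex.im h

lemma continuous_one_div_sub (hz : z.im ≠ 0) : Continuous fun x : ℝ => 1 / (z - (x : ℂ)) :=
  continuous_const.div (by fun_prop) (sub_ofReal_ne_zero hz)

lemma norm_one_div_sub_le (hz : z.im ≠ 0) (x : ℝ) : ‖1 / (z - (x : ℂ))‖ ≤ 1 / |z.im| := by
  rw [norm_div, norm_one]
  refine one_div_le_one_div_of_le (abs_pos.2 hz) ?_
  simpa using Complex.abs_im_le_norm (z - x)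

lemma integrable_one_div_sub (μ : Measure ℝ) [IsFiniteMeasure μ] (hz : z.im ≠ 0) :
    Integrable (fun x : ℝ => 1 / (z - (x : ℂ))) μ :=
  Integrable.of_bound (continuous_one_div_sub hz).aestronglyMeasurable _
    (.of_forall (norm_one_div_sub_le hz))

/-- A probability measure satisfies `z G(z) → 1` as `z → -i∞`. -/
lemma tendsto_mul_cauchyStieltjes (μ : Measure ℝ) [IsProbabilityMeasure μ] :
    Tendsto (fun y : ℝ => (-(y : ℂ) * Complex.I) * cauchyStieltjes μ (-(y : ℂ) * Complex.I))
      atTop (𝓝 1) := by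
  have him : ∀ y : ℝ, (-(y : ℂ) * Complex.I).im = -y := fun y => by simp
  have h : Tendsto (fun y : ℝ => ∫ x : ℝ, (-(y : ℂ) * Complex.I) *
      (1 / (-(y : ℂ) * Complex.I - x)) ∂μ) atTop (𝓝 (∫ _ : ℝ, (1 : ℂ) ∂μ)) := by
    refine tendsto_integral_filter_of_dominated_convergence (fun _ => 1) ?_ ?_
      (integrable_const _) ?_
    · filter_upwards [eventually_gt_atTop 0] with y hy
      exact (continuous_const.mul (continuous_one_div_sub
        (by rw [him]; exact (neg_neg_of_pos hy).ne))).aestronglyMeasurable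
    · filter_upwards [eventually_gt_atTop 0] with y hy
      refine .of_forall fun x => ?_
      have h1 := norm_one_div_sub_le (z := -(y : ℂ) * Complex.I)
        (by rw [him]; exact (neg_neg_of_pos hy).ne) x
      rw [him, abs_neg, abs_of_pos hy] at h1
      rw [norm_mul]
      have h2 : ‖-(y : ℂ) * Complex.I‖ = y := by simp [abs_of_pos hy]
      rw [h2]
      calc _ ≤ y * (1 / y) := by gcongr
        _ = 1 := by field_simp
    · refine .of_forall fun x => ?_
      have h1 : Tendsto (fun y : ℝ => ((x / y : ℝ) : ℂ)) atTop (𝓝 0) := by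
        rw [← Complex.ofReal_zero]
        exact (Complex.continuous_ofReal.tendsto 0).comp (tendsto_const_nhds.div_atTop tendsto_id)
      have h2 : Tendsto (fun y : ℝ => (1 - Complex.I * ((x / y : ℝ) : ℂ))⁻¹) atTop (𝓝 1) := by
        have := ((h1.const_mul Complex.I).const_sub 1).inv₀ (by simp)
        simpa using this
      refine h2.congr' ?_
      filter_upwards [eventually_gt_atTop 0] with y hy
      have hy' : (y : ℂ) ≠ 0 := by exact_mod_cast hy.ne'
      have hne := sub_ofReal_ne_zero (z := -(y : ℂ) * Complex.I)
        (by rw [him]; exact (neg_neg_of_pos hy).ne) x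
      have hfac : -(y : ℂ) * Complex.I - x =
          -(y : ℂ) * Complex.I * (1 - Complex.I * ((x / y : ℝ) : ℂ)) := by
        push_cast
        field_simp
        linear_combination -(x : ℂ) * Complex.I_sq
      rw [mul_one_div, hfac, ← div_div, div_self (by simp [hy']), one_div]
  simp_rw [integral_const_mul] at h
  rw [integral_const, probReal_univ, one_smul] at h
  exact h

end CauchyStieltjes

/-! ### From the density to the expansion of the Cauchy transform. -/

section Forward

variable {S : AddSubmonoid ℝ} {c A : ℝ}

lemma exp_lowerLog {x : ℝ} (hx : x ≠ 0) : Complex.exp (lowerLog x) = x := by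
  rcases hx.lt_or_gt with h | h
  · have := lowerLog_neg_exp (Real.log (-x))
    rw [Real.exp_log (by linarith), neg_neg] at this
    rw [this, Complex.exp_add, ← Complex.ofReal_exp, Real.exp_log (by linarith)]
    simp [Complex.exp_neg]
  · rw [lowerLog, if_pos h, ← Complex.ofReal_exp, Real.exp_log h]

lemma exp_lowerLog_re {x : ℝ} (hx : x ≠ 0) : Real.exp (lowerLog x).re = |x| := by
  rw [lowerLog_re, Real.exp_log (abs_pos.2 hx)]

/-- The exponent γ = 0 contributes Im(a_0/x) = 0 as a_0 is real, so summing over S or over positive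
exponents is the same. -/
lemma hasSum_im_invRealPow (hS : IsExponentSet S c) (hA : 0 < A) {a : S → ℂ}
    (ha : ∀ γ, ‖a γ‖ ≤ A ^ (γ : ℝ)) (h0 : (a 0).im = 0) {x : ℝ} (hx : c * A < |x|) :
    HasSum (fun β : {β : ℝ // β ∈ S ∧ 0 < β} =>
      (a ⟨β, β.2.1⟩ * invRealPow x ((β : ℝ) + 1)).im)
      (expSum a (lowerLog x) * Complex.exp (-lowerLog x)).im := by
  have hx0 : x ≠ 0 := by
    have := hS.pos
    exact abs_pos.1 (lt_trans (by positivity) hx)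
  have h1 := ((summable_norm_expSum hS hA ha (ζ := lowerLog x)
    (by rwa [exp_lowerLog_re hx0])).of_norm.hasSum.mul_right (Complex.exp (-lowerLog x))).mapL
    Complex.imCLM
  have hinj : Function.Injective
      (fun β : {β : ℝ // β ∈ S ∧ 0 < β} => (⟨β, β.2.1⟩ : S)) := fun α β h =>
    Subtype.ext (congrArg (fun γ : S => (γ : ℝ)) h)
  rw [← hinj.hasSum_iff] at h1
  · have hterm : ∀ β : {β : ℝ // β ∈ S ∧ 0 < β},
        (a ⟨β, β.2.1⟩ * invRealPow x ((β : ℝ) + 1)).im =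
          (a ⟨β, β.2.1⟩ * Complex.exp (-((β : ℝ) : ℂ) * lowerLog x) *
            Complex.exp (-lowerLog x)).im := by
      intro β
      rw [invRealPow_eq_exp hx0, mul_assoc, ← Complex.exp_add]
      push_cast
      ring_nf
    simp_rw [hterm]
    exact h1
  · intro γ hγ
    have hγ0 : γ = 0 := by
      by_contra hne
      exact hγ ⟨⟨γ, γ.2, hS.coe_pos hne⟩, rfl⟩
    subst hγ0
    simp [Complex.exp_neg, exp_lowerLog hx0, h0]

lemma exists_expSum_of_laurent (hS : IsExponentSet S c) {r R : ℝ} (hr : 0 < r) (hrR : r ≤ R)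
    {a : S → ℂ} (ha : ∀ γ, ‖a γ‖ ≤ r ^ (γ : ℝ)) {g : ℂ → ℂ} (hg : HasLaurentExpansion R g) :
    ∃ (d : S → ℂ) (C : ℝ), (∀ γ, ‖d γ‖ ≤ C * R ^ (γ : ℝ)) ∧
      ∀ z : ℂ, z.im < 0 → c * R < ‖z‖ → expSum d (Complex.log z) =
        z * (Real.pi * (expSum a (Complex.log z) * Complex.exp (-Complex.log z)) + g z) := by
  obtain ⟨m, C, hm, hs⟩ := hg
  have hR : 0 < R := hr.trans_le hrR
  have hC : 0 ≤ C := by simpa using (norm_nonneg _).trans (hm 0)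
  have hinj := hS.natCast_injective
  -- Laurent coefficients are placed at the integer exponents of S, with zero elsewhere.
  set e : S → ℂ := Function.extend hS.natCast m 0 with he
  have heb : ∀ γ, ‖e γ‖ ≤ C * R ^ (γ : ℝ) := by
    intro γ
    by_cases h : ∃ n, hS.natCast n = γ
    · obtain ⟨n, rfl⟩ := h
      rw [he, hinj.extend_apply, hS.coe_natCast, Real.rpow_natCast]
      exact hm n
    · rw [he, Function.extend_apply' _ _ _ h]
      simp only [Pi.zero_apply, norm_zero]
      positivity
  refine ⟨fun γ => Real.pi * a γ + e γ, Real.pi + C, fun γ => ?_, fun z hz hzR => ?_⟩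
  · rw [add_mul]
    refine norm_add_le_of_le ?_ (heb γ)
    rw [norm_mul, Complex.norm_real, Real.norm_of_nonneg Real.pi_pos.le]
    exact mul_le_mul_of_nonneg_left ((ha γ).trans
      (Real.rpow_le_rpow hr.le hrR (hS.coe_nonneg γ))) Real.pi_pos.le
  · have hc := hS.one_le
    have hz0 : z ≠ 0 := by
      rintro rfl
      simp at hz
    have h1 : HasSum (fun γ : S => a γ * Complex.exp (-((γ : ℝ) : ℂ) * Complex.log z))
        (expSum a (Complex.log z)) :=
      (summable_norm_expSum hS hr ha (by
        rw [exp_log_re hz0]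
        nlinarith)).of_norm.hasSum
    have h2 : HasSum (fun γ : S => e γ * Complex.exp (-((γ : ℝ) : ℂ) * Complex.log z))
        (z * g z) := by
      rw [← hinj.hasSum_iff]
      · have h3 := (hs z hz (by nlinarith)).mul_left z
        have hterm : (fun γ : S => e γ * Complex.exp (-((γ : ℝ) : ℂ) * Complex.log z)) ∘
            hS.natCast = fun n => z * (m n / z ^ (n + 1)) := by
          funext n
          simp only [Function.comp, hS.coe_natCast]
          rw [he, hinj.extend_apply, exp_neg_mul_log hz0]
          simp only [Complex.ofReal_natCast, Complex.cpow_natCast]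
          rw [pow_succ]
          field_simp
        rw [hterm]
        exact h3
      · rintro γ hγ
        rw [he, Function.extend_apply' _ _ _ hγ, Pi.zero_apply, zero_mul]
    have h3 := ((h1.mul_left (Real.pi : ℂ)).add h2).tsum_eq
    rw [Complex.exp_neg, Complex.exp_log hz0, mul_add]
    field_simp
    rw [← h3]
    refine tsum_congr fun γ => ?_
    ring

/-- Along z = -iy the series tends to d 0 and z G(z) tends to the total mass 1. Dividing by max(C,
1) puts the coefficient bound in the form without a constant. -/
lemma coeff_zero_eq_one (hS : IsExponentSet S c) (μ : Measure ℝ) [IsProbabilityMeasure μ]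
    {R C : ℝ} (hR : 0 < R) {d : S → ℂ} (hd : ∀ γ, ‖d γ‖ ≤ C * R ^ (γ : ℝ))
    (h : ∀ z : ℂ, z.im < 0 → c * R < ‖z‖ →
      expSum d (Complex.log z) = z * cauchyStieltjes μ z) : d 0 = 1 := by
  set C' : ℝ := max C 1 with hC'
  have hCpos : 0 < C' := one_pos.trans_le (le_max_right _ _)
  have hCne : (C' : ℂ) ≠ 0 := by exact_mod_cast hCpos.ne'
  have hd' : ∀ γ, ‖(C' : ℂ)⁻¹ * d γ‖ ≤ R ^ (γ : ℝ) := by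
    intro γ
    rw [norm_mul, norm_inv, Complex.norm_real, Real.norm_of_nonneg hCpos.le, inv_mul_le_iff₀ hCpos]
    exact (hd γ).trans (mul_le_mul_of_nonneg_right (le_max_left _ _) (by positivity))
  have hexp : ∀ ζ, expSum (fun γ => (C' : ℂ)⁻¹ * d γ) ζ = (C' : ℂ)⁻¹ * expSum d ζ := by
    intro ζ
    rw [expSum, expSum, ← tsum_mul_left]
    exact tsum_congr fun γ => by ring
  have hre : Tendsto (fun y : ℝ => Complex.log (-(y : ℂ) * Complex.I)) atTop
      (comap Complex.re atTop) := by
    refine tendsto_comap_iff.2 (Real.tendsto_log_atTop.congr' ?_)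
    filter_upwards [eventually_gt_atTop 0] with y hy
    simp [Complex.log_re, abs_of_pos hy]
  have h1 := (tendsto_expSum hS hR hd').comp hre
  have h2 := (tendsto_mul_cauchyStieltjes μ).const_mul (C' : ℂ)⁻¹
  have h3 := tendsto_nhds_unique h1 (h2.congr' (by
    filter_upwards [eventually_gt_atTop 0, eventually_gt_atTop (c * R)] with y hy hy2
    rw [Function.comp, hexp, h _ (by simpa using hy) (by simpa [abs_of_pos hy] using hy2)]))
  field_simp at h3
  exact h3

/-- The Cauchy transform of a measure with the density `Im F(log x)` on `{|x| ≥ R}`. -/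
lemma exists_cauchyStieltjes_eq_add_laurent {μ : Measure ℝ} [IsFiniteMeasure μ] {F : ℂ → ℂ}
    {L L₀ M : ℝ} (hL : L₀ < L) (hF : DifferentiableOn ℂ F {ζ | L₀ < ζ.re})
    (hM : ∀ ζ : ℂ, L ≤ ζ.re → ‖F ζ‖ ≤ M * Real.exp (-ζ.re))
    (hpos : ∀ x : ℝ, Real.exp L ≤ |x| → 0 ≤ (F (lowerLog x)).im)
    (hμ : μ.restrict {x : ℝ | Real.exp L ≤ |x|} =
      (volume.restrict {x : ℝ | Real.exp L ≤ |x|}).withDensity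
        fun x => ENNReal.ofReal (F (lowerLog x)).im) :
    ∃ g, HasLaurentExpansion (Real.exp L) g ∧ ∀ z : ℂ, z.im < 0 → Real.exp L < ‖z‖ →
      cauchyStieltjes μ z = Real.pi * F (Complex.log z) + g z := by
  set E : Set ℝ := {x : ℝ | Real.exp L ≤ |x|} with hE
  have hEm : MeasurableSet E := measurableSet_le measurable_const (by fun_prop)
  -- Measurability is recovered from the integrable function F/(i - x) by multiplying by i - x.
  have hmeas : AEMeasurable (fun x => ENNReal.ofReal (F (lowerLog x)).im) (volume.restrict E) := by
    have h1 := (integral_outside_lowerLog (z := Complex.I) hL hF hM (by simp)).1.1.aemeasurable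
    have h2 : AEMeasurable (fun x : ℝ => Complex.I - (x : ℂ)) (volume.restrict E) := by fun_prop
    refine (Complex.measurable_im.comp_aemeasurable ((h1.mul h2).congr
      (.of_forall fun x => ?_))).ennreal_ofReal
    exact div_mul_cancel₀ _ (sub_ofReal_ne_zero (by simp) x)
  obtain ⟨m, C, hm, hs⟩ := exists_laurent_integral (μ.restrict Eᶜ) (k := fun _ => 1)
    (w := fun x : ℝ => (x : ℂ)) (K := 1) aestronglyMeasurable_const
    (by fun_prop) (Real.exp_pos L) (by simp) (by
      filter_upwards [ae_restrict_mem hEm.compl] with x hx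
      rw [Complex.norm_real]
      exact (not_le.1 (show ¬Real.exp L ≤ |x| from hx)).le)
  have hin : HasLaurentExpansion (Real.exp L) fun z => ∫ x in Eᶜ, 1 / (z - (x : ℂ)) ∂μ :=
    ⟨m, C, hm, fun z _ hz => hs z hz⟩
  refine ⟨_, hin.add (((hasLaurentExpansion_arcIntegral hL hF hM).add
    (hasLaurentExpansion_conj_arcIntegral hL hF hM)).const_mul (-(1 / 2))), fun z hz hzL => ?_⟩
  rw [cauchyStieltjes, ← integral_add_compl hEm (integrable_one_div_sub μ hz.ne), hμ,
    integral_withDensity_eq_integral_toReal_smul₀ hmeas (by simp)]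
  have h := integral_im_outside hL hF hM hz hzL
  have hcongr : ∫ x in E, (ENNReal.ofReal (F (lowerLog x)).im).toReal • (1 / (z - (x : ℂ))) =
      ∫ x in E, ((F (lowerLog x)).im : ℂ) / (z - x) := by
    refine setIntegral_congr_fun hEm fun x hx => ?_
    simp only [ENNReal.toReal_ofReal (hpos x hx), Complex.real_smul]
    ring
  rw [hcongr, h]
  ring

end Forward

/-! ### Stieltjes inversion for the lower half-plane. -/

section StieltjesInversion

variable {μ : Measure ℝ} {ε a b : ℝ}

/-- `π` times the Poisson kernel of the half-plane. -/
def poissonKernelLine (ε x t : ℝ) : ℝ := ε / ((x - t) ^ 2 + ε ^ 2)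

lemma continuous_poissonKernelLine (hε : 0 < ε) :
    Continuous fun p : ℝ × ℝ => poissonKernelLine ε p.1 p.2 :=
  continuous_const.div (by fun_prop) fun p => by positivity

lemma poissonKernelLine_nonneg (hε : 0 < ε) (x t : ℝ) : 0 ≤ poissonKernelLine ε x t := by
  unfold poissonKernelLine
  positivity

lemma poissonKernelLine_le (hε : 0 < ε) (x t : ℝ) : poissonKernelLine ε x t ≤ 1 / ε := by
  unfold poissonKernelLine
  rw [div_le_div_iff₀ (by positivity) hε]
  nlinarith [sq_nonneg (x - t)]

lemma norm_poissonKernelLine_le (hε : 0 < ε) (x t : ℝ) : ‖poissonKernelLine ε x t‖ ≤ 1 / ε := by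
  rw [Real.norm_of_nonneg (poissonKernelLine_nonneg hε x t)]
  exact poissonKernelLine_le hε x t

lemma im_cauchyStieltjes [IsFiniteMeasure μ] (hε : 0 < ε) (x : ℝ) :
    (cauchyStieltjes μ (x - ε * Complex.I)).im = ∫ t, poissonKernelLine ε x t ∂μ := by
  have him : ((x : ℂ) - ε * Complex.I).im ≠ 0 := by simpa using hε.ne'
  rw [cauchyStieltjes, ← Complex.imCLM_apply,
    ← Complex.imCLM.integral_comp_comm (integrable_one_div_sub μ him)]
  refine integral_congr_ae (.of_forall fun t => ?_)
  simp only [Complex.imCLM_apply, one_div, Complex.inv_im, Complex.normSq_apply, poissonKernelLine]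
  simp
  ring

lemma continuous_integral_poissonKernelLine [IsFiniteMeasure μ] (hε : 0 < ε) :
    Continuous fun x => ∫ t, poissonKernelLine ε x t ∂μ :=
  continuous_of_dominated
    (fun x => ((continuous_poissonKernelLine hε).comp (by fun_prop :
      Continuous fun t : ℝ => (x, t))).aestronglyMeasurable)
    (fun x => .of_forall (norm_poissonKernelLine_le hε x)) (integrable_const _)
    (.of_forall fun t => (continuous_poissonKernelLine hε).comp (by fun_prop :
      Continuous fun x : ℝ => (x, t)))

lemma integral_poissonKernelLine (hε : 0 < ε) (a b t : ℝ) :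
    ∫ x in a..b, poissonKernelLine ε x t =
      Real.arctan ((b - t) / ε) - Real.arctan ((a - t) / ε) := by
  refine intervalIntegral.integral_eq_sub_of_hasDerivAt
    (f := fun x => Real.arctan ((x - t) / ε)) (fun x _ => ?_) ?_
  · have h := (((hasDerivAt_id x).sub_const t).div_const ε).arctan
    have heq : poissonKernelLine ε x t = 1 / (1 + ((id x - t) / ε) ^ 2) * (1 / ε) := by
      unfold poissonKernelLine
      simp only [id]
      field_simp
      ring
    rw [heq]
    exact h
  · exact ((continuous_poissonKernelLine hε).comp (by fun_prop :
      Continuous fun x : ℝ => (x, t))).intervalIntegrable _ _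

lemma integral_im_cauchyStieltjes [IsFiniteMeasure μ] (hε : 0 < ε) (hab : a ≤ b) :
    ∫ x in a..b, (cauchyStieltjes μ (x - ε * Complex.I)).im =
      ∫ t, (Real.arctan ((b - t) / ε) - Real.arctan ((a - t) / ε)) ∂μ := by
  simp_rw [im_cauchyStieltjes hε, ← integral_poissonKernelLine hε,
    intervalIntegral.integral_of_le hab]
  refine integral_integral_swap ?_
  exact Integrable.of_bound (continuous_poissonKernelLine hε).aestronglyMeasurable (1 / ε)
    (.of_forall fun p => norm_poissonKernelLine_le hε p.1 p.2)

lemma tendsto_arctan_div (u : ℝ) :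
    Tendsto (fun ε : ℝ => Real.arctan (u / ε)) (𝓝[>] 0) (𝓝 (Real.pi / 2 * Real.sign u)) := by
  rcases lt_trichotomy u 0 with h | h | h
  · rw [Real.sign_of_neg h, mul_neg_one, ← neg_div]
    have h1 : Tendsto (fun ε : ℝ => u / ε) (𝓝[>] 0) atBot :=
      tendsto_inv_nhdsGT_zero.const_mul_atTop_of_neg h
    rw [neg_div]
    exact tendsto_nhds_of_tendsto_nhdsWithin (Real.tendsto_arctan_atBot.comp h1)
  · subst h
    simp
  · rw [Real.sign_of_pos h, mul_one]
    have h1 : Tendsto (fun ε : ℝ => u / ε) (𝓝[>] 0) atTop :=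
      tendsto_inv_nhdsGT_zero.const_mul_atTop h
    exact tendsto_nhds_of_tendsto_nhdsWithin (Real.tendsto_arctan_atTop.comp h1)

/-- The arctangents are bounded and converge to sign functions. When a < b, endpoint atoms count
with half weight, since sign 0 = 0. -/
lemma tendsto_integral_im_cauchyStieltjes [IsFiniteMeasure μ] (hab : a ≤ b) :
    Tendsto (fun ε : ℝ => ∫ x in a..b, (cauchyStieltjes μ (x - ε * Complex.I)).im) (𝓝[>] 0)
      (𝓝 (∫ t, (Real.pi / 2 * Real.sign (b - t) - Real.pi / 2 * Real.sign (a - t)) ∂μ)) := by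
  have h : Tendsto (fun ε : ℝ => ∫ t, (Real.arctan ((b - t) / ε) - Real.arctan ((a - t) / ε)) ∂μ)
      (𝓝[>] 0)
      (𝓝 (∫ t, (Real.pi / 2 * Real.sign (b - t) - Real.pi / 2 * Real.sign (a - t)) ∂μ)) := by
    refine tendsto_integral_filter_of_dominated_convergence (fun _ => Real.pi) ?_ ?_
      (integrable_const _)
      (.of_forall fun t => (tendsto_arctan_div (b - t)).sub (tendsto_arctan_div (a - t)))
    · refine .of_forall fun ε => Continuous.aestronglyMeasurable ?_
      fun_prop
    · refine .of_forall fun ε => .of_forall fun t => ?_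
      rw [Real.norm_eq_abs, abs_le]
      have h1 := Real.arctan_lt_pi_div_two ((b - t) / ε)
      have h2 := Real.arctan_lt_pi_div_two ((a - t) / ε)
      have h3 := Real.neg_pi_div_two_lt_arctan ((b - t) / ε)
      have h4 := Real.neg_pi_div_two_lt_arctan ((a - t) / ε)
      constructor <;> linarith
  refine h.congr' ?_
  filter_upwards [self_mem_nhdsWithin] with ε hε
  exact (integral_im_cauchyStieltjes hε hab).symm

variable {g : ℝ → ℝ} {R M : ℝ}

/-- The **Stieltjes inversion formula**, without assumptions about atoms. -/
lemma integral_boundary_value_eq [IsFiniteMeasure μ]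
    (hlim : ∀ x : ℝ, R ≤ |x| → Tendsto (fun ε : ℝ => (cauchyStieltjes μ (x - ε * Complex.I)).im)
      (𝓝[>] 0) (𝓝 (g x)))
    (hbd : ∀ z : ℂ, z.im < 0 → R ≤ ‖z‖ → ‖cauchyStieltjes μ z‖ ≤ M)
    (hab : a ≤ b) (hsub : ∀ x ∈ Icc a b, R ≤ |x|) :
    ∫ x in a..b, g x =
      ∫ t, (Real.pi / 2 * Real.sign (b - t) - Real.pi / 2 * Real.sign (a - t)) ∂μ := by
  refine tendsto_nhds_unique ?_ (tendsto_integral_im_cauchyStieltjes hab)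
  refine intervalIntegral.tendsto_integral_filter_of_dominated_convergence (fun _ => M) ?_ ?_
    intervalIntegrable_const ?_
  · filter_upwards [self_mem_nhdsWithin] with ε hε
    simp_rw [im_cauchyStieltjes hε]
    exact (continuous_integral_poissonKernelLine hε).aestronglyMeasurable
  · filter_upwards [self_mem_nhdsWithin] with ε hε
    refine .of_forall fun x hx => ?_
    rw [uIoc_of_le hab] at hx
    refine (Complex.abs_im_le_norm _).trans (hbd _ (by simpa using hε) ?_)
    refine (hsub x (Ioc_subset_Icc_self hx)).trans ?_
    simpa using Complex.abs_re_le_norm ((x : ℂ) - ε * Complex.I)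
  · refine .of_forall fun x hx => ?_
    rw [uIoc_of_le hab] at hx
    exact hlim x (hsub x (Ioc_subset_Icc_self hx))

lemma boundary_value_nonneg [IsFiniteMeasure μ] {x y : ℝ}
    (hlim : Tendsto (fun ε : ℝ => (cauchyStieltjes μ (x - ε * Complex.I)).im) (𝓝[>] 0) (𝓝 y)) :
    0 ≤ y := by
  refine ge_of_tendsto hlim ?_
  filter_upwards [self_mem_nhdsWithin] with ε hε
  rw [im_cauchyStieltjes hε]
  exact integral_nonneg fun t => poissonKernelLine_nonneg hε x t

lemma boundary_value_le (hbd : ∀ z : ℂ, z.im < 0 → R ≤ ‖z‖ → ‖cauchyStieltjes μ z‖ ≤ M)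
    {x y : ℝ} (hx : R ≤ |x|)
    (hlim : Tendsto (fun ε : ℝ => (cauchyStieltjes μ (x - ε * Complex.I)).im) (𝓝[>] 0) (𝓝 y)) :
    y ≤ M := by
  refine le_of_tendsto hlim ?_
  filter_upwards [self_mem_nhdsWithin] with ε hε
  refine (le_abs_self _).trans ((Complex.abs_im_le_norm _).trans
    (hbd _ (by simpa using hε) (hx.trans ?_)))
  simpa using Complex.abs_re_le_norm ((x : ℂ) - ε * Complex.I)

lemma sign_sub_sign_eq {a b t : ℝ} (hab : a < b) (ha : t ≠ a) (hb : t ≠ b) :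
    Real.pi / 2 * Real.sign (b - t) - Real.pi / 2 * Real.sign (a - t) =
      (Icc a b).indicator (fun _ => Real.pi) t := by
  rcases lt_or_gt_of_ne ha with h | h
  · rw [Real.sign_of_pos (sub_pos.2 h), Real.sign_of_pos (sub_pos.2 (h.trans hab)),
      indicator_of_notMem (fun h' : t ∈ Icc a b => absurd h'.1 (not_le.2 h)), sub_self]
  · rw [Real.sign_of_neg (sub_neg.2 h)]
    rcases lt_or_gt_of_ne hb with h' | h'
    · rw [Real.sign_of_pos (sub_pos.2 h'), indicator_of_mem (show t ∈ Icc a b from ⟨h.le, h'.le⟩)]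
      ring
    · rw [Real.sign_of_neg (sub_neg.2 h'),
        indicator_of_notMem (fun h'' : t ∈ Icc a b => absurd h''.2 (not_le.2 h')), sub_self]

lemma sign_monotone : Monotone Real.sign := by
  intro x y h
  rcases lt_trichotomy x 0 with hx | hx | hx <;> rcases lt_trichotomy y 0 with hy | hy | hy <;>
    simp [Real.sign_of_neg, Real.sign_of_pos, *] <;> linarith

lemma norm_sign_le_one (x : ℝ) : ‖Real.sign x‖ ≤ 1 := by
  rcases Real.sign_apply_eq x with h | h | h <;> simp [h]

/-- Inversion on [x - δ, x + δ] gives at least π μ{x}, whereas the boundary values, bounded by M,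
integrate to at most 2δM. Let δ → 0. -/
lemma measure_singleton_eq_zero_of_boundary_value [IsFiniteMeasure μ]
    (hlim : ∀ x : ℝ, R ≤ |x| → Tendsto (fun ε : ℝ => (cauchyStieltjes μ (x - ε * Complex.I)).im)
      (𝓝[>] 0) (𝓝 (g x)))
    (hbd : ∀ z : ℂ, z.im < 0 → R ≤ ‖z‖ → ‖cauchyStieltjes μ z‖ ≤ M) {x : ℝ} (hx : R < |x|) :
    μ {x} = 0 := by
  have hkey : ∀ δ, 0 < δ → δ ≤ |x| - R → Real.pi * μ.real {x} ≤ M * (2 * δ) := by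
    intro δ hδ hδ'
    have hsub : ∀ y ∈ Icc (x - δ) (x + δ), R ≤ |y| := by
      intro y hy
      have h1 : |x - y| ≤ δ := abs_le.2 ⟨by linarith [hy.2], by linarith [hy.1]⟩
      have h2 := abs_sub_abs_le_abs_sub x y
      linarith
    have heq := integral_boundary_value_eq hlim hbd (by linarith : x - δ ≤ x + δ) hsub
    have hup : ∫ y in (x - δ)..(x + δ), g y ≤ M * (2 * δ) := by
      have h3 : ‖∫ y in (x - δ)..(x + δ), g y‖ ≤ M * |x + δ - (x - δ)| := by
        refine intervalIntegral.norm_integral_le_of_norm_le_const fun y hy => ?_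
        rw [uIoc_of_le (by linarith)] at hy
        have h4 := hsub y (Ioc_subset_Icc_self hy)
        rw [Real.norm_of_nonneg (boundary_value_nonneg (hlim y h4))]
        exact boundary_value_le hbd h4 (hlim y h4)
      have h5 : |x + δ - (x - δ)| = 2 * δ := by
        rw [show x + δ - (x - δ) = 2 * δ by ring, abs_of_pos (by linarith)]
      rw [h5] at h3
      exact (le_abs_self _).trans h3
    refine le_trans ?_ hup
    rw [heq]
    have hm : ∀ u : ℝ, Measurable fun t : ℝ => Real.sign (u - t) := fun u =>
      sign_monotone.measurable.comp (measurable_const.sub measurable_id)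
    have hint : Integrable (fun t => Real.pi / 2 * Real.sign (x + δ - t) -
        Real.pi / 2 * Real.sign (x - δ - t)) μ := by
      refine Integrable.sub ?_ ?_ <;>
      · refine Integrable.const_mul (Integrable.of_bound (hm _).aestronglyMeasurable 1
          (.of_forall fun t => ?_)) _
        exact norm_sign_le_one _
    calc Real.pi * μ.real {x} = ∫ t, ({x} : Set ℝ).indicator (fun _ => Real.pi) t ∂μ := by
          rw [integral_indicator (measurableSet_singleton x), setIntegral_const, smul_eq_mul,
            mul_comm]
      _ ≤ _ := by
          refine integral_mono ((integrable_const _).indicator (measurableSet_singleton x)) hint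
            fun t => ?_
          by_cases h : t = x
          · subst h
            rw [indicator_of_mem (mem_singleton t)]
            simp only [add_sub_cancel_left, sub_sub_cancel_left]
            rw [Real.sign_of_pos hδ, Real.sign_of_neg (neg_neg_of_pos hδ)]
            linarith
          · rw [indicator_of_notMem (by simpa using h)]
            have := sign_monotone (by linarith : x - δ - t ≤ x + δ - t)
            have hpi := Real.pi_pos
            simp only
            nlinarith
  have hlim0 : Tendsto (fun δ : ℝ => M * (2 * δ)) (𝓝[>] 0) (𝓝 0) := by
    refine tendsto_nhdsWithin_of_tendsto_nhds ?_
    have : Continuous fun δ : ℝ => M * (2 * δ) := by fun_prop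
    simpa using this.tendsto 0
  have h0 : Real.pi * μ.real {x} ≤ 0 := by
    refine ge_of_tendsto hlim0 ?_
    filter_upwards [Ioc_mem_nhdsGT (sub_pos.2 hx)] with δ hδ
    exact hkey δ hδ.1 hδ.2
  have h1 : μ.real {x} = 0 :=
    le_antisymm (by nlinarith [Real.pi_pos]) measureReal_nonneg
  rwa [measureReal_eq_zero_iff] at h1

lemma measure_Icc_of_boundary_value [IsFiniteMeasure μ]
    (hlim : ∀ x : ℝ, R ≤ |x| → Tendsto (fun ε : ℝ => (cauchyStieltjes μ (x - ε * Complex.I)).im)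
      (𝓝[>] 0) (𝓝 (g x)))
    (hbd : ∀ z : ℂ, z.im < 0 → R ≤ ‖z‖ → ‖cauchyStieltjes μ z‖ ≤ M)
    (hg : ContinuousOn g {x | R ≤ |x|}) (hsub : ∀ x ∈ Icc a b, R < |x|) :
    μ (Icc a b) = ∫⁻ x in Icc a b, ENNReal.ofReal (g x / Real.pi) := by
  rcases lt_trichotomy a b with hab | rfl | hab
  · have hz : ∀ x ∈ Icc a b, ∀ᵐ t ∂μ, t ≠ x := fun x hx => by
      rw [ae_iff]
      simpa using measure_singleton_eq_zero_of_boundary_value hlim hbd (hsub x hx)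
    have heq := integral_boundary_value_eq hlim hbd hab.le fun x hx => (hsub x hx).le
    have hind : ∫ t, (Real.pi / 2 * Real.sign (b - t) - Real.pi / 2 * Real.sign (a - t)) ∂μ =
        μ.real (Icc a b) * Real.pi := by
      rw [← smul_eq_mul, ← setIntegral_const, ← integral_indicator measurableSet_Icc]
      refine integral_congr_ae ?_
      filter_upwards [hz a ⟨le_rfl, hab.le⟩, hz b ⟨hab.le, le_rfl⟩] with t h1 h2
      exact sign_sub_sign_eq hab h1 h2
    rw [hind] at heq
    have hgc : ContinuousOn g (Icc a b) := hg.mono fun x hx => (hsub x hx).le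
    rw [← ofReal_integral_eq_lintegral_ofReal (hgc.integrableOn_Icc.div_const _)
      ((ae_restrict_mem measurableSet_Icc).mono fun x hx =>
        div_nonneg (boundary_value_nonneg (hlim x (hsub x hx).le)) Real.pi_pos.le),
      integral_div, integral_Icc_eq_integral_Ioc, ← intervalIntegral.integral_of_le hab.le, heq,
      mul_div_cancel_right₀ _ Real.pi_pos.ne', ofReal_measureReal]
  · rw [Icc_self, measure_singleton_eq_zero_of_boundary_value hlim hbd (hsub a (by simp))]
    simp
  · simp [Icc_eq_empty (not_le.2 hab)]

/-- The **Stieltjes inversion formula** outside a bounded interval. -/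
theorem restrict_eq_withDensity_of_boundary_value [IsFiniteMeasure μ] {R' : ℝ} (hR' : R < R')
    (hpos : 0 < R') (hlim : ∀ x : ℝ, R ≤ |x| →
      Tendsto (fun ε : ℝ => (cauchyStieltjes μ (x - ε * Complex.I)).im) (𝓝[>] 0) (𝓝 (g x)))
    (hbd : ∀ z : ℂ, z.im < 0 → R ≤ ‖z‖ → ‖cauchyStieltjes μ z‖ ≤ M)
    (hg : ContinuousOn g {x | R ≤ |x|}) :
    μ.restrict {x : ℝ | R' ≤ |x|} = (volume.restrict {x : ℝ | R' ≤ |x|}).withDensity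
      fun x => ENNReal.ofReal (g x / Real.pi) := by
  have hdisj : Disjoint (Iic (-R')) (Ici R') := by
    rw [Set.disjoint_left]
    intro x hx hx'
    rw [mem_Iic] at hx
    rw [mem_Ici] at hx'
    linarith
  -- Each closed half-line meets a compact interval in a compact interval, so agreement on such
  -- intervals determines the restriction.
  have hext : ∀ V : Set ℝ, MeasurableSet V → (∀ a b, ∃ a' b', Icc a b ∩ V = Icc a' b') →
      (∀ x ∈ V, R < |x|) → μ.restrict V =
        (volume.restrict V).withDensity fun x => ENNReal.ofReal (g x / Real.pi) := by
    intro V hV hVI hVR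
    refine Measure.ext_of_Icc _ _ fun a b _ => ?_
    rw [Measure.restrict_apply measurableSet_Icc, withDensity_apply _ measurableSet_Icc,
      Measure.restrict_restrict measurableSet_Icc]
    obtain ⟨a', b', h⟩ := hVI a b
    rw [h]
    exact measure_Icc_of_boundary_value hlim hbd hg fun x hx => hVR x (h ▸ hx : x ∈ _ ∩ V).2
  rw [setOf_le_abs, Measure.restrict_union hdisj measurableSet_Ici,
    Measure.restrict_union hdisj measurableSet_Ici, withDensity_add_measure,
    hext _ measurableSet_Iic (fun a b => ⟨a, min b (-R'), ?_⟩) fun x hx => ?_,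
    hext _ measurableSet_Ici (fun a b => ⟨max a R', b, ?_⟩) fun x hx => ?_]
  · ext x
    simp only [mem_inter_iff, mem_Icc, mem_Ici, max_le_iff]
    tauto
  · exact hR'.trans_le ((mem_Ici.1 hx).trans (le_abs_self x))
  · ext x
    simp only [mem_inter_iff, mem_Icc, mem_Iic, le_min_iff]
    tauto
  · have := neg_le_abs x
    rw [mem_Iic] at hx
    linarith

end StieltjesInversion

/-! ### The two implications between membership in the class and the expansion of G. -/

section Equivalences

variable {S : AddSubmonoid ℝ} {c A : ℝ} {μ : Measure ℝ}

lemma ne_zero_of_im_neg {z : ℂ} (hz : z.im < 0) : z ≠ 0 := by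
  rintro rfl
  simp at hz

lemma summable_div_cpow (hS : IsExponentSet S c) (hA : 0 < A) {d : S → ℂ}
    (hd : ∀ γ, ‖d γ‖ ≤ A ^ (γ : ℝ)) {z : ℂ} (hz : z ≠ 0) (hzA : c * A < ‖z‖) :
    Summable fun γ : S => d γ / z ^ ((γ : ℝ) : ℂ) := by
  simp_rw [← expSum_term_log hz]
  exact (summable_norm_expSum hS hA hd (by rwa [exp_log_re hz])).of_norm

lemma tsum_div_cpow {z : ℂ} (hz : z ≠ 0) (d : S → ℂ) :
    ∑' γ : S, d γ / z ^ ((γ : ℝ) : ℂ) = expSum d (Complex.log z) :=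
  tsum_congr fun γ => (expSum_term_log hz d γ).symm

lemma summable_div_cpow_add_one (hS : IsExponentSet S c) (hA : 0 < A) {d : S → ℂ}
    (hd : ∀ γ, ‖d γ‖ ≤ A ^ (γ : ℝ)) {z : ℂ} (hz : z ≠ 0) (hzA : c * A < ‖z‖) :
    Summable fun γ : S => d γ / z ^ (((γ : ℝ) : ℂ) + 1) := by
  simp_rw [div_cpow_add_one hz]
  exact (summable_norm_expSum hS hA hd (by rwa [exp_log_re hz])).of_norm.mul_left _

lemma tsum_div_cpow_add_one {z : ℂ} (hz : z ≠ 0) (d : S → ℂ) :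
    ∑' γ : S, d γ / z ^ (((γ : ℝ) : ℂ) + 1) = z⁻¹ * expSum d (Complex.log z) := by
  simp_rw [div_cpow_add_one hz, tsum_mul_left]
  rfl

lemma differentiableOn_expSum_mul_exp_neg (hS : IsExponentSet S c) {r : ℝ} (hr : 0 < r)
    {a : S → ℂ} (ha : ∀ γ, ‖a γ‖ ≤ r ^ (γ : ℝ)) {σ : ℝ} (hσ : c * r < Real.exp σ) :
    DifferentiableOn ℂ (fun ζ => expSum a ζ * Complex.exp (-ζ)) {ζ | σ < ζ.re} := fun ζ hζ =>
  ((differentiableAt_expSum hS hr ha (hσ.trans (Real.exp_lt_exp.2 hζ))).mul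
    (by fun_prop)).differentiableWithinAt

lemma norm_expSum_mul_exp_neg_le (hS : IsExponentSet S c) {r : ℝ} (hr : 0 < r)
    {a : S → ℂ} (ha : ∀ γ, ‖a γ‖ ≤ r ^ (γ : ℝ)) {σ : ℝ} (hσ : c * r < Real.exp σ) {ζ : ℂ}
    (hζ : σ ≤ ζ.re) : ‖expSum a ζ * Complex.exp (-ζ)‖ ≤
      (∑' γ : S, (r * Real.exp (-σ)) ^ (γ : ℝ)) * Real.exp (-ζ.re) := by
  rw [norm_mul, Complex.norm_exp, Complex.neg_re]
  exact mul_le_mul_of_nonneg_right (norm_expSum_le hS hr ha hσ hζ) (Real.exp_pos _).le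

/-- The Cauchy transform of a measure in `𝒫_S` has an expansion in powers with exponents in
`S`. -/
theorem MemPS.exists_cauchyStieltjes_expansion [IsProbabilityMeasure μ] (hS : IsExponentSet S c)
    (h : MemPS S c μ) : ∃ (d : S → ℂ) (A : ℝ), d 0 = 1 ∧ 0 < A ∧ (∀ γ : S, ‖d γ‖ ≤ A ^ (γ : ℝ)) ∧
      ∀ z : ℂ, z.im < 0 → c * A < ‖z‖ →
        cauchyStieltjes μ z = z⁻¹ * expSum d (Complex.log z) := by
  classical
  obtain ⟨a, r, R, ρ, hr, hR, hρ, hμ, ha, hrR⟩ := h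
  have hc := hS.one_le
  have hcr : c * r < R := by
    rwa [inv_mul_eq_div, lt_div_iff₀ hS.pos, mul_comm] at hrR
  have hrR' : r ≤ R := by nlinarith
  set a' : S → ℂ := fun γ => if h : (0 : ℝ) < γ then a ⟨γ, γ.2, h⟩ else 0 with ha'
  have ha'b : ∀ γ, ‖a' γ‖ ≤ r ^ (γ : ℝ) := by
    intro γ
    rw [ha']
    dsimp only
    split_ifs with h
    · exact ha ⟨γ, γ.2, h⟩
    · rw [norm_zero]
      positivity
  have ha'0 : (a' 0).im = 0 := by simp [ha']
  have hρF : ∀ x : ℝ, R ≤ |x| →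
      ρ x = (expSum a' (lowerLog x) * Complex.exp (-lowerLog x)).im := by
    intro x hx
    refine (hρ x hx).2.unique ?_
    convert hasSum_im_invRealPow hS hr ha'b ha'0 (hcr.trans_le hx) using 4 with β
    simp [ha', β.2.2]
  -- The strict inequality cr < R leaves room to have holomorphy on an open half-plane containing Re
  -- ζ ≥ log R.
  obtain ⟨L₀, h1, h2⟩ := exists_between (Real.log_lt_log (by positivity) hcr)
  rw [Real.log_lt_iff_lt_exp (by positivity)] at h1
  have hexpL := Real.exp_log hR
  have hE : {x : ℝ | R ≤ |x|} = {x : ℝ | Real.exp (Real.log R) ≤ |x|} := by rw [hexpL]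
  have hEm : MeasurableSet {x : ℝ | R ≤ |x|} := measurableSet_le measurable_const (by fun_prop)
  obtain ⟨g, hg, hG⟩ := exists_cauchyStieltjes_eq_add_laurent (μ := μ) h2
    (differentiableOn_expSum_mul_exp_neg hS hr ha'b h1)
    (fun ζ hζ => norm_expSum_mul_exp_neg_le hS hr ha'b (by rwa [hexpL]) hζ)
    (fun x hx => by
      rw [hexpL] at hx
      rw [← hρF x hx]
      exact (hρ x hx).1)
    (by
      rw [← hE, hμ]
      refine withDensity_congr_ae ?_
      filter_upwards [ae_restrict_mem hEm] with x hx
      rw [hρF x hx])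
  rw [hexpL] at hg hG
  obtain ⟨d, C, hd, hdz⟩ := exists_expSum_of_laurent hS hr hrR' ha'b hg
  have hdG : ∀ z : ℂ, z.im < 0 → c * R < ‖z‖ →
      expSum d (Complex.log z) = z * cauchyStieltjes μ z := by
    intro z hz hzR
    rw [hdz z hz hzR, hG z hz (by nlinarith)]
  have hd0 := coeff_zero_eq_one hS μ hR hd hdG
  obtain ⟨A, hRA, hA⟩ := hS.exists_rpow_bound (C := C) hR
  refine ⟨d, A, hd0, hR.trans_le hRA, fun γ => ?_, fun z hz hzA => ?_⟩
  -- The constant C can be absorbed into the base only for γ ≠ 0; at γ = 0 the bound holds because d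
  -- 0 = 1.
  · by_cases hγ : γ = 0
    · subst hγ
      simp [hd0]
    · exact (hd γ).trans (hA γ hγ)
  · rw [hdG z hz ((mul_le_mul_of_nonneg_left hRA hS.pos.le).trans_lt hzA),
      inv_mul_cancel_left₀ (ne_zero_of_im_neg hz)]

lemma tendsto_log_sub_mul_I {x : ℝ} (hx : x ≠ 0) :
    Tendsto (fun ε : ℝ => Complex.log (x - ε * Complex.I)) (𝓝[>] 0) (𝓝 (lowerLog x)) := by
  have hc : Tendsto (fun ε : ℝ => (x : ℂ) - ε * Complex.I) (𝓝[>] 0) (𝓝 (x : ℂ)) := by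
    have : Continuous fun ε : ℝ => (x : ℂ) - ε * Complex.I := by fun_prop
    simpa using (this.tendsto 0).mono_left nhdsWithin_le_nhds
  rcases hx.lt_or_gt with h | h
  · have h1 := Complex.tendsto_log_nhdsWithin_im_neg_of_re_neg_of_im_zero (z := x)
      (by simpa using h) (by simp)
    have h2 : lowerLog x = Real.log ‖(x : ℂ)‖ - Real.pi * Complex.I := by
      rw [lowerLog, if_neg h.not_gt, Complex.norm_real, Real.norm_eq_abs]
      push_cast
      ring
    rw [h2]
    refine h1.comp (tendsto_nhdsWithin_iff.2 ⟨hc, ?_⟩)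
    filter_upwards [self_mem_nhdsWithin] with ε hε
    simpa using hε
  · rw [lowerLog, if_pos h, Complex.ofReal_log h.le]
    exact (continuousAt_clog (Or.inl (by simpa using h))).tendsto.comp hc

lemma continuousAt_lowerLog {x : ℝ} (hx : x ≠ 0) : ContinuousAt lowerLog x := by
  rcases hx.lt_or_gt with h | h
  · have h1 : ContinuousAt (fun x : ℝ => (Real.log |x| : ℂ) + (-Real.pi : ℝ) * Complex.I) x := by
      have : ContinuousAt (fun x : ℝ => Real.log |x|) x :=
        (Real.continuousAt_log (abs_ne_zero.2 hx)).comp continuous_abs.continuousAt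
      exact (Complex.continuous_ofReal.continuousAt.comp this).add continuousAt_const
    refine h1.congr ?_
    filter_upwards [gt_mem_nhds h] with y hy
    rw [lowerLog, if_neg (not_lt.2 (le_of_lt hy))]
  · have h1 : ContinuousAt (fun x : ℝ => (Real.log x : ℂ)) x :=
      Complex.continuous_ofReal.continuousAt.comp (Real.continuousAt_log hx)
    refine h1.congr ?_
    filter_upwards [lt_mem_nhds h] with y hy
    rw [lowerLog, if_pos hy]

/-- A measure belongs to `𝒫_S` if its Cauchy transform has an expansion in powers with exponents
in `S`. -/
theorem memPS_of_cauchyStieltjes_expansion [IsFiniteMeasure μ] (hS : IsExponentSet S c)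
    {d : S → ℂ} (hd0 : d 0 = 1) (hA : 0 < A) (hd : ∀ γ : S, ‖d γ‖ ≤ A ^ (γ : ℝ))
    (hG : ∀ z : ℂ, z.im < 0 → c * A < ‖z‖ →
      cauchyStieltjes μ z = z⁻¹ * expSum d (Complex.log z)) : MemPS S c μ := by
  have hcA : 0 < c * A := mul_pos hS.pos hA
  -- R₁ > cA makes the bound on G uniform; R > R₁ leaves a neighbourhood of ±R in which atoms are
  -- excluded.
  obtain ⟨R₁, hR₁⟩ := exists_gt (c * A)
  obtain ⟨R, hR⟩ := exists_gt R₁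
  have hR₁0 := hcA.trans hR₁
  have hne : ∀ x : ℝ, R₁ ≤ |x| → x ≠ 0 := fun x hx => abs_pos.1 (hR₁0.trans_le hx)
  have hre : ∀ x : ℝ, R₁ ≤ |x| → c * A < Real.exp (lowerLog x).re := fun x hx => by
    rw [exp_lowerLog_re (hne x hx)]
    exact hR₁.trans_le hx
  set H : ℂ → ℂ := fun ζ => expSum d ζ * Complex.exp (-ζ) with hH
  have hHc : ∀ x : ℝ, R₁ ≤ |x| → ContinuousAt H (lowerLog x) := fun x hx =>
    ((differentiableAt_expSum hS hA hd (hre x hx)).mul (by fun_prop)).continuousAt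
  have hGH : ∀ z : ℂ, z.im < 0 → c * A < ‖z‖ → cauchyStieltjes μ z = H (Complex.log z) := by
    intro z hz hzA
    simp only [hH]
    rw [hG z hz hzA, mul_comm, Complex.exp_neg, Complex.exp_log (ne_zero_of_im_neg hz)]
  have hlim : ∀ x : ℝ, R₁ ≤ |x| →
      Tendsto (fun ε : ℝ => (cauchyStieltjes μ (x - ε * Complex.I)).im) (𝓝[>] 0)
        (𝓝 (H (lowerLog x)).im) := by
    intro x hx
    refine ((Complex.continuous_im.tendsto _).comp ((hHc x hx).tendsto.comp
      (tendsto_log_sub_mul_I (hne x hx)))).congr' ?_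
    filter_upwards [self_mem_nhdsWithin] with ε hε
    rw [hGH _ (by simpa using hε)]
    · rfl
    · refine (hR₁.trans_le hx).trans_le ?_
      simpa using Complex.abs_re_le_norm ((x : ℂ) - ε * Complex.I)
  have hexpR := Real.exp_log hR₁0
  have hbd : ∀ z : ℂ, z.im < 0 → R₁ ≤ ‖z‖ → ‖cauchyStieltjes μ z‖ ≤
      (∑' γ : S, (A * Real.exp (-Real.log R₁)) ^ (γ : ℝ)) * R₁⁻¹ := by
    intro z hz hzR
    have hz0 := ne_zero_of_im_neg hz
    have hle : Real.log R₁ ≤ (Complex.log z).re := by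
      rw [Complex.log_re]
      exact Real.log_le_log hR₁0 hzR
    rw [hGH z hz (hR₁.trans_le hzR)]
    refine (norm_expSum_mul_exp_neg_le hS hA hd (by rwa [hexpR]) hle).trans ?_
    refine mul_le_mul_of_nonneg_left ?_ (tsum_nonneg fun γ => by positivity)
    rw [Real.exp_neg, exp_log_re hz0]
    exact inv_anti₀ hR₁0 hzR
  have hcont : ContinuousOn (fun x => (H (lowerLog x)).im) {x | R₁ ≤ |x|} := fun x hx =>
    (Complex.continuous_im.continuousAt.comp ((hHc x hx).comp
      (continuousAt_lowerLog (hne x hx)))).continuousWithinAt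
  have hinv := restrict_eq_withDensity_of_boundary_value hR (hR₁0.trans hR) hlim hbd hcont
  have hpi := Real.pi_pos
  refine ⟨fun β => d ⟨β, β.2.1⟩ / Real.pi, A, R, fun x => (H (lowerLog x)).im / Real.pi, hA,
    hR₁0.trans hR, fun x hx => ⟨?_, ?_⟩, hinv, fun β => ?_, ?_⟩
  · exact div_nonneg (boundary_value_nonneg (hlim x (hR.le.trans hx))) hpi.le
  · have h := (hasSum_im_invRealPow hS hA hd (by simp [hd0])
      (hR₁.trans (hR.trans_le hx))).div_const Real.pi
    simpa only [div_mul_eq_mul_div, Complex.div_ofReal_im] using h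
  · rw [norm_div, Complex.norm_real, Real.norm_of_nonneg hpi.le]
    exact (div_le_self (norm_nonneg _) (by linarith [Real.pi_gt_three])).trans (hd ⟨β, β.2.1⟩)
  · rw [inv_mul_eq_div, lt_div_iff₀ hS.pos, mul_comm]
    exact hR₁.trans hR

end Equivalences

end

theorem theorem3p3 (S : AddSubmonoid ℝ) (c : ℝ) (hS : IsExponentSet S c)
    (μ : MeasureTheory.Measure ℝ) [MeasureTheory.IsProbabilityMeasure μ] :
    List.TFAE [
      MemPS S c μ,
      ∃ (d : S → ℂ) (A : ℝ), d 0 = 1 ∧ 0 < A ∧ (∀ γ : S, ‖d γ‖ ≤ A ^ (γ : ℝ)) ∧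
        ∀ z : ℂ, z.im < 0 → c * A < ‖z‖ →
          Summable (fun γ : S => d γ / z ^ (((γ : ℝ) : ℂ) + 1)) ∧
          cauchyStieltjes μ z = ∑' γ : S, d γ / z ^ (((γ : ℝ) : ℂ) + 1),
      ∃ (b : S → ℂ) (A : ℝ), b 0 = 1 ∧ 0 < A ∧ (∀ γ : S, ‖b γ‖ ≤ A ^ (γ : ℝ)) ∧
        ∀ z : ℂ, z.im < 0 → c * A < ‖z‖ →
          Summable (fun γ : S => b γ / z ^ ((γ : ℝ) : ℂ)) ∧
          reciprocalCauchy μ z = z * ∑' γ : S, b γ / z ^ ((γ : ℝ) : ℂ)] := by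
  tfae_have 1 → 2 := by
    intro h
    obtain ⟨d, A, hd0, hA, hd, hG⟩ := h.exists_cauchyStieltjes_expansion hS
    refine ⟨d, A, hd0, hA, hd, fun z hz hzA => ?_⟩
    have hz0 := ne_zero_of_im_neg hz
    exact ⟨summable_div_cpow_add_one hS hA hd hz0 hzA, by
      rw [tsum_div_cpow_add_one hz0, hG z hz hzA]⟩
  tfae_have 2 → 1 := by
    rintro ⟨d, A, hd0, hA, hd, hG⟩
    refine memPS_of_cauchyStieltjes_expansion hS hd0 hA hd fun z hz hzA => ?_
    rw [(hG z hz hzA).2, tsum_div_cpow_add_one (ne_zero_of_im_neg hz)]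
  tfae_have 2 → 3 := by
    rintro ⟨d, A, hd0, hA, hd, hG⟩
    obtain ⟨b, B, hAB, hb0, hb, hdb⟩ := hS.exists_expSum_inverse hA hd0 hd
    refine ⟨b, B, hb0, hA.trans_le hAB, hb, fun z hz hzB => ?_⟩
    have hz0 := ne_zero_of_im_neg hz
    refine ⟨summable_div_cpow hS (hA.trans_le hAB) hb hz0 hzB, ?_⟩
    have hone := hdb (Complex.log z) (by rwa [exp_log_re hz0])
    rw [tsum_div_cpow hz0, reciprocalCauchy,
      (hG z hz ((mul_le_mul_of_nonneg_left hAB hS.pos.le).trans_lt hzB)).2,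
      tsum_div_cpow_add_one hz0, eq_inv_of_mul_eq_one_right hone]
    simp [mul_comm]
  tfae_have 3 → 2 := by
    rintro ⟨b, A, hb0, hA, hb, hF⟩
    obtain ⟨d, B, hAB, hd0, hd, hbd⟩ := hS.exists_expSum_inverse hA hb0 hb
    refine ⟨d, B, hd0, hA.trans_le hAB, hd, fun z hz hzB => ?_⟩
    have hz0 := ne_zero_of_im_neg hz
    refine ⟨summable_div_cpow_add_one hS (hA.trans_le hAB) hd hz0 hzB, ?_⟩
    have hone := hbd (Complex.log z) (by rwa [exp_log_re hz0])
    -- Since B ≥ A, the domain |z| > cB lies in the one where the given expansion holds.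
    have h := (hF z hz ((mul_le_mul_of_nonneg_left hAB hS.pos.le).trans_lt hzB)).2
    rw [tsum_div_cpow hz0, reciprocalCauchy, one_div] at h
    rw [tsum_div_cpow_add_one hz0, eq_inv_of_mul_eq_one_right hone, ← mul_inv, ← h, inv_inv]
  tfae_finish
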